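/- Let $R$ be a commutative unital ring whose only idempotents are $0$ and $1$, let $\Gamma$ be a discrete group with identity $\epsilon$, and let $G$ be an ample Hausdorff groupoid (a Hausdorff topological groupoid with a basis of compact open bisections). Let $(\Sigma,i,q,c_G)$ be a $\Gamma$-graded discrete $R$-twist over $G$: that is, $\Sigma$ is a topological groupoid and $G^{(0)}\times R^{\times}\xrightarrow{\,i\,}\Sigma\xrightarrow{\,q\,}G$ is a sequence of continuous groupoid homomorphisms ($R^\times$ discrete) that restrict to homeomorphisms of unit spaces, with $\Sigma^{(0)}=i(G^{(0)}\times\{1\})$, such that $i$ is injective, $q$ is surjective, $i(\{x\}\times R^\times)=q^{-1}(x)$ for all $x\in G^{(0)}$, the image of $i$ is central, and $\Sigma$ is locally trivial (each $\alpha\in G$ lies in an open bisection $B$ with a continuous section $P:B\to\Sigma$ of $q$ for which $(\beta,t)\mapsto i(r(\beta),t)P(\beta)$ is a homeomorphism $B\times R^\times\to q^{-1}(B)$); moreover $c_G:G\to\Gamma$ is a continuous homomorphism and $c_\Sigma=c_G\circ q$. Write $G_\gamma=c_G^{-1}(\gamma)$ and $\Sigma_\gamma=q^{-1}(G_\gamma)$;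 restricting $i$ and $q$ makes $\Sigma_\epsilon$ a discrete $R$-twist over $G_\epsilon$. The twisted Steinberg algebra $A_R(G;\Sigma)$ consists of the locally constant functions $f:\Sigma\to R$ with $f(i(r(\sigma),t)\sigma)=t^{-1}f(\sigma)$ for all $t\in R^\times$, $\sigma\in\Sigma$, and such that $\operatorname{supp}_G(f):=q(\{\sigma: f(\sigma)\neq 0\})$ is compact, with pointwise linear structure and the product $(f*g)(\sigma)=\sum_{\alpha\in \operatorname{supp}_G(f),\,r(\alpha)=r(q(\sigma))}f(S(\alpha))\,g(S(\alpha)^{-1}\sigma)$, where $S$ is any set-theoretic section of $q$. Let $A=A_R(G;\Sigma)$ with homogeneous components $A_\gamma=\{f:\operatorname{supp}_G(f)\subseteq G_\gamma\}$, and let $C=\{f\in A:\operatorname{supp}_G(f)\subseteq G^{(0)}\}$, i.e. $C=A_R(G^{(0)};q^{-1}(G^{(0)}))$. For a commutative subalgebra $D$ of an $R$-algebra $B$, let $I(D)$ be its set of idempotents. A normaliser of $D$ in $B$ is an $n\in B$ for which there is $m\in B$ with $mnm=m$, $nmn=n$ and $mDn\cup nDm\subseteq D$; it is free if $n\in D$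 or $(mn)(nm)=0$ for such an $m$. Let $N(D)$ be the set of normalisers. A conditional expectation $P:B\to D$ is an $R$-linear map with $P|_D=\mathrm{id}$ and $P(dbd')=dP(b)d'$; it is faithful if for every $b\neq 0$ there is $n\in N(D)$ with $P(nb)\neq0$, and implemented by idempotents if for every $n\in N(D)$ there is $e\in I(D)$ with $P(n)=ne=en$. Suppose that $te=0$ with $t\in R$, $0\neq e\in I(D)$ implies $t=0$; that every finite subset of $B$ has a two-sided unit in $I(D)$; that $I(D)$ spans $D$ and $N(D)$ spans $B$; and that there is a faithful conditional expectation $B\to D$. Then $(B,D)$ is an ADP if the free normalisers span $B$, an ACP if $D$ is a maximal commutative subalgebra of $B$, and an AQP if some faithful conditional expectation $B\to D$ is implemented by idempotents. If $B=\bigoplus_{\gamma\in\Gamma}B_\gamma$ is $\Gamma$-graded and $D\subseteq B_\epsilon$, then $(B,D)$ is a gr-ADP (respectively gr-ACP, gr-AQP) if $(B_\epsilon,D)$ is an ADP (respectively ACP, AQP) and $B$ is spanned by the normalisers of $D$ in $B$ that lie in some $B_\gamma$. Then the following hold. 1. If $G_\epsilon$ is effective (the interior of $\{\alpha\in G_\epsilon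 : r(\alpha)=s(\alpha)\}$ is the unit space), then $(A,C)$ is a gr-ACP. 2. If $G_\epsilon$ is principal ($r(\alpha)=s(\alpha)$ only for units $\alpha$), then $(A,C)$ is a gr-ADP. 3. $(A,C)$ is a gr-AQP if and only if the twist $\Sigma_\epsilon$ over $G_\epsilon$ satisfies the local bisection hypothesis: for every normaliser $n$ of $A_R(G_\epsilon^{(0)};q^{-1}(G_\epsilon^{(0)}))$ in $A_R(G_\epsilon;\Sigma_\epsilon)$, the set $\operatorname{supp}_{G_\epsilon}(n)$ is an open bisection of $G_\epsilon$. -/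

import Mathlib

open Set Topology

/-! ### Groupoids, topological groupoids, ample groupoids -/

/-- A groupoid, given by its set of arrows.  The pair `(a, b)` is composable when
`a⁻¹ * a = b * b⁻¹`; the value of `a * b` is only meaningful for composable pairs, and every
axiom on products is restricted to such pairs. -/
class ArrowGroupoid (G : Type*) extends Mul G, Inv G where
  inv_inv_eq : ∀ a : G, (a⁻¹)⁻¹ = a
  source_mul : ∀ a b : G, a⁻¹ * a = b * b⁻¹ → (a * b)⁻¹ * (a * b) = b⁻¹ * b
  range_mul : ∀ a b : G, a⁻¹ * a = b * b⁻¹ → (a * b) * (a * b)⁻¹ = a * a⁻¹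
  assoc : ∀ a b c : G, a⁻¹ * a = b * b⁻¹ → b⁻¹ * b = c * c⁻¹ → (a * b) * c = a * (b * c)
  inv_mul_cancel_left : ∀ a b : G, a⁻¹ * a = b * b⁻¹ → a⁻¹ * (a * b) = b
  mul_inv_cancel_right : ∀ a b : G, a⁻¹ * a = b * b⁻¹ → (a * b) * b⁻¹ = a

namespace ArrowGroupoid

section Algebra

variable {G : Type*} [ArrowGroupoid G]

/-- The source `s(a) = a⁻¹ a`. -/
def src (a : G) : G := a⁻¹ * a

/-- The range `r(a) = a a⁻¹`. -/
def rng (a : G) : G := a * a⁻¹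

/-- `(a, b)` belongs to the set of composable pairs. -/
def Composable (a b : G) : Prop := src a = rng b

variable (G) in
/-- The unit space, the set of all sources. -/
def units : Set G := Set.range (src : G → G)

variable (G) in
/-- The isotropy, the set of arrows whose range and source agree. -/
def isotropy : Set G := {a | rng a = src a}

theorem src_inv (a : G) : src a⁻¹ = rng a := by
  simp [src, rng, inv_inv_eq]

theorem rng_inv (a : G) : rng a⁻¹ = src a := by
  simp [src, rng, inv_inv_eq]

theorem composable_inv_left (a : G) : Composable a⁻¹ a := src_inv a

theorem composable_inv_right (a : G) : Composable a a⁻¹ := (rng_inv a).symm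

theorem src_mul {a b : G} (h : Composable a b) : src (a * b) = src b := source_mul a b h

theorem rng_mul {a b : G} (h : Composable a b) : rng (a * b) = rng a := range_mul a b h

theorem mul_assoc' {a b c : G} (h : Composable a b) (k : Composable b c) :
    a * b * c = a * (b * c) := assoc a b c h k

theorem inv_mul_cancel {a b : G} (h : Composable a b) : a⁻¹ * (a * b) = b :=
  inv_mul_cancel_left a b h

theorem mul_inv_cancel {a b : G} (h : Composable a b) : a * b * b⁻¹ = a :=
  mul_inv_cancel_right a b h

theorem mul_inv_mul {a b : G} (h : rng a = rng b) : a * (a⁻¹ * b) = b := by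
  have k : Composable a⁻¹ b := by rw [Composable, src_inv, h]
  simpa [inv_inv_eq] using inv_mul_cancel k

theorem src_src (a : G) : src (src a) = src a := src_mul (composable_inv_left a)

theorem rng_src (a : G) : rng (src a) = src a := by
  have := rng_mul (composable_inv_left a)
  rwa [rng_inv] at this

theorem src_rng (a : G) : src (rng a) = rng a := by
  have := src_mul (composable_inv_right a)
  rwa [src_inv] at this

theorem rng_rng (a : G) : rng (rng a) = rng a := rng_mul (composable_inv_right a)

theorem mul_src (a : G) : a * src a = a := by
  have := inv_mul_cancel (composable_inv_left a)
  rwa [inv_inv_eq] at this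

theorem rng_mul_self (a : G) : rng a * a = a := by
  have := mul_inv_cancel (composable_inv_right a)
  rwa [inv_inv_eq] at this

theorem src_mem_units (a : G) : src a ∈ units G := ⟨a, rfl⟩

theorem rng_mem_units (a : G) : rng a ∈ units G := ⟨a⁻¹, src_inv a⟩

theorem src_of_mem_units {a : G} (h : a ∈ units G) : src a = a := by
  obtain ⟨b, rfl⟩ := h
  exact src_src b

theorem rng_of_mem_units {a : G} (h : a ∈ units G) : rng a = a := by
  obtain ⟨b, rfl⟩ := h
  exact rng_src b

theorem inv_of_mem_units {a : G} (h : a ∈ units G) : a⁻¹ = a := by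
  have h1 := mul_src a⁻¹
  rw [src_inv, rng_of_mem_units h] at h1
  rw [← h1]
  exact src_of_mem_units h

theorem mul_mem_units {a b : G} (h : Composable a b) (ha : a ∈ units G) (hb : b ∈ units G) :
    a * b ∈ units G := by
  have : a = b := by
    have h' : src a = rng b := h
    rwa [src_of_mem_units ha, rng_of_mem_units hb] at h'
  subst this
  have := mul_src a
  rw [src_of_mem_units ha] at this
  rwa [this]

theorem mul_left_cancel' {a b c : G} (h : Composable a b) (k : Composable a c)
    (e : a * b = a * c) : b = c := by
  rw [← inv_mul_cancel h, e, inv_mul_cancel k]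

theorem composable_of_inv {a b : G} (h : Composable a b) : Composable b⁻¹ a⁻¹ := by
  rw [Composable, src_inv, rng_inv]
  exact h.symm

theorem mul_inv_rev' {a b : G} (h : Composable a b) : (a * b)⁻¹ = b⁻¹ * a⁻¹ := by
  have h1 : Composable b⁻¹ a⁻¹ := composable_of_inv h
  have h2 : Composable (a * b) (b⁻¹ * a⁻¹) := by
    rw [Composable, src_mul h, rng_mul h1, rng_inv]
  refine mul_left_cancel' (composable_inv_right _) h2 ?_
  have h3 : Composable b (b⁻¹ * a⁻¹) := by
    rw [Composable, rng_mul h1, rng_inv]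
  rw [mul_assoc' h h3, mul_inv_mul (by rw [rng_inv]; exact h.symm)]
  exact rng_mul h

/-- Groupoid homomorphisms. -/
def IsHom {H : Type*} [ArrowGroupoid H] (f : G → H) : Prop :=
  ∀ a b : G, Composable a b → Composable (f a) (f b) ∧ f (a * b) = f a * f b

theorem IsHom.map_mul {H : Type*} [ArrowGroupoid H] {f : G → H} (hf : IsHom f) {a b : G}
    (h : Composable a b) : f (a * b) = f a * f b := (hf a b h).2

theorem IsHom.composable {H : Type*} [ArrowGroupoid H] {f : G → H} (hf : IsHom f) {a b : G}
    (h : Composable a b) : Composable (f a) (f b) := (hf a b h).1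

theorem IsHom.map_src {H : Type*} [ArrowGroupoid H] {f : G → H} (hf : IsHom f) (a : G) :
    f (src a) = src (f a) := by
  have hc : Composable a (src a) := by rw [Composable, rng_src]
  have h1 : f a * f (src a) = f a := by rw [← hf.map_mul hc, mul_src]
  have h2 : Composable (f a) (f (src a)) := hf.composable hc
  refine mul_left_cancel' h2 (by rw [Composable, rng_src]) ?_
  rw [h1, mul_src]

theorem IsHom.map_inv {H : Type*} [ArrowGroupoid H] {f : G → H} (hf : IsHom f) (a : G) :
    f a⁻¹ = (f a)⁻¹ := by
  have hc : Composable a a⁻¹ := composable_inv_right a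
  have hd : Composable a⁻¹ a := composable_inv_left a
  have h1 : f a⁻¹ * f a = (f a)⁻¹ * f a := by
    rw [← hf.map_mul hd]
    exact hf.map_src a
  have h2 : f a⁻¹ = f a⁻¹ * f a * (f a)⁻¹ := (mul_inv_cancel (hf.composable hd)).symm
  rw [h2, h1, mul_inv_cancel (composable_inv_left _)]

theorem IsHom.map_rng {H : Type*} [ArrowGroupoid H] {f : G → H} (hf : IsHom f) (a : G) :
    f (rng a) = rng (f a) := by
  rw [← src_inv, hf.map_src, hf.map_inv, src_inv]

end Algebra

section Topology

variable (G : Type*) [ArrowGroupoid G] [TopologicalSpace G]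

/-- Inversion and composition are continuous. -/
class IsTopological : Prop where
  continuous_inv : Continuous fun a : G => a⁻¹
  continuousOn_mul : ContinuousOn (fun p : G × G => p.1 * p.2) {p | Composable p.1 p.2}

variable {G} in
/-- Open bisections: open sets `B` on which range and source are homeomorphisms onto their
(open) images. -/
structure IsOpenBisection (B : Set G) : Prop where
  isOpen : IsOpen B
  isOpen_rng : IsOpen (rng '' B)
  isOpen_src : IsOpen (src '' B)
  isEmbedding_rng : IsEmbedding (B.domRestrict rng)
  isEmbedding_src : IsEmbedding (B.domRestrict src)

/-- Ample: the compact open bisections form a basis of the topology. -/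
class IsAmple : Prop where
  isTopologicalBasis :
    TopologicalSpace.IsTopologicalBasis {B : Set G | IsCompact B ∧ IsOpenBisection B}

/-- Principal: the isotropy consists of the units. -/
def IsPrincipal (G : Type*) [ArrowGroupoid G] : Prop := isotropy G = units G

/-- Effective: the interior of the isotropy is the unit space. -/
def IsEffective : Prop := interior (isotropy G) = units G

variable {G}

theorem continuous_mul_of [IsTopological G] {X : Type*} [TopologicalSpace X] {f g : X → G}
    (hf : Continuous f) (hg : Continuous g) (h : ∀ x, Composable (f x) (g x)) :
    Continuous fun x => f x * g x :=
  (IsTopological.continuousOn_mul (G := G)).comp_continuous (hf.prodMk hg) h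

theorem continuous_inv' [IsTopological G] : Continuous fun a : G => a⁻¹ :=
  IsTopological.continuous_inv

theorem continuous_rng [IsTopological G] : Continuous (rng : G → G) :=
  continuous_mul_of continuous_id continuous_inv' composable_inv_right

theorem continuous_src [IsTopological G] : Continuous (src : G → G) :=
  continuous_mul_of continuous_inv' continuous_id composable_inv_left

theorem IsOpenBisection.injOn_rng {B : Set G} (hB : IsOpenBisection B) : InjOn rng B :=
  injOn_iff_injective.2 hB.isEmbedding_rng.injective

theorem isOpen_image_of_embedding {X Y : Type*} [TopologicalSpace X] [TopologicalSpace Y]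
    {f : X → Y} {B U : Set X} (he : IsEmbedding (B.domRestrict f)) (ho : IsOpen (f '' B))
    (hU : IsOpen U) (hUB : U ⊆ B) : IsOpen (f '' U) := by
  have h1 : IsOpenEmbedding (B.domRestrict f) := ⟨he, by rwa [range_domRestrict]⟩
  have h2 := h1.isOpenMap _ (hU.preimage continuous_subtype_val)
  convert h2 using 1
  ext y
  constructor
  · rintro ⟨x, hx, rfl⟩
    exact ⟨⟨x, hUB hx⟩, hx, rfl⟩
  · rintro ⟨x, hx, rfl⟩
    exact ⟨x, hx, rfl⟩

theorem IsOpenBisection.mono {B U : Set G} (hB : IsOpenBisection B) (hU : IsOpen U)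
    (hUB : U ⊆ B) : IsOpenBisection U where
  isOpen := hU
  isOpen_rng := isOpen_image_of_embedding hB.isEmbedding_rng hB.isOpen_rng hU hUB
  isOpen_src := isOpen_image_of_embedding hB.isEmbedding_src hB.isOpen_src hU hUB
  isEmbedding_rng := hB.isEmbedding_rng.comp (IsEmbedding.inclusion hUB)
  isEmbedding_src := hB.isEmbedding_src.comp (IsEmbedding.inclusion hUB)

/-- A compact set meets every fibre of the range map in a finite set. -/
theorem finite_fibre_inter [IsAmple G] {K : Set G} (hK : IsCompact K) (x : G) :
    ({a | rng a = x} ∩ K).Finite := by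
  have key : ∀ a ∈ K, ∃ U ∈ 𝓝[K] a, ({a | rng a = x} ∩ U).Finite := by
    intro a _
    obtain ⟨B, ⟨-, hB⟩, haB, -⟩ :=
      (IsAmple.isTopologicalBasis (G := G)).exists_subset_of_mem_open (mem_univ a) isOpen_univ
    refine ⟨B, mem_nhdsWithin_of_mem_nhds (hB.isOpen.mem_nhds haB), ?_⟩
    refine Set.Subsingleton.finite ?_
    rintro b ⟨hb, hbB⟩ c ⟨hc, hcB⟩
    exact hB.injOn_rng hbB hcB (hb.trans hc.symm)
  refine hK.induction_on (p := fun U => ({a | rng a = x} ∩ U).Finite) (by simp) ?_ ?_ key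
  · intro s t hst ht
    exact ht.subset (inter_subset_inter_right _ hst)
  · intro s t hs ht
    rw [inter_union_distrib_left]
    exact hs.union ht

end Topology

/-! ### Open subgroupoids -/

/-- An open subgroupoid. -/
structure OpenSubgroupoid (G : Type*) [ArrowGroupoid G] [TopologicalSpace G] where
  carrier : Set G
  isOpen : IsOpen carrier
  mul_mem : ∀ {a b : G}, a ∈ carrier → b ∈ carrier → Composable a b → a * b ∈ carrier
  inv_mem : ∀ {a : G}, a ∈ carrier → a⁻¹ ∈ carrier

namespace OpenSubgroupoid

variable {G : Type*} [ArrowGroupoid G] [TopologicalSpace G]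

instance : CoeSort (OpenSubgroupoid G) (Type _) := ⟨fun H => {a : G // a ∈ H.carrier}⟩

variable (H : OpenSubgroupoid G)

open Classical in
/-- The product of a composable pair is the product in the ambient groupoid. -/
noncomputable instance : Mul H :=
  ⟨fun a b => if h : Composable a.1 b.1 then ⟨a.1 * b.1, H.mul_mem a.2 b.2 h⟩ else a⟩

instance : Inv H := ⟨fun a => ⟨a.1⁻¹, H.inv_mem a.2⟩⟩

theorem coe_inv (a : H) : (a⁻¹).1 = a.1⁻¹ := rfl

open Classical in
theorem coe_mul {a b : H} (h : Composable a.1 b.1) : (a * b).1 = a.1 * b.1 := by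
  change (dite _ _ _ : H).1 = _
  rw [dif_pos h]

theorem coe_inv_mul (a : H) : (a⁻¹ * a).1 = src a.1 := coe_mul H (composable_inv_left a.1)

theorem coe_mul_inv (a : H) : (a * a⁻¹).1 = rng a.1 := coe_mul H (composable_inv_right a.1)

theorem composable_aux {a b : H} (h : a⁻¹ * a = b * b⁻¹) : Composable a.1 b.1 := by
  have := congrArg Subtype.val h
  rwa [coe_inv_mul, coe_mul_inv] at this

noncomputable instance : ArrowGroupoid H where
  inv_inv_eq a := Subtype.ext (inv_inv_eq a.1)
  source_mul a b h := by
    have h := composable_aux H h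
    apply Subtype.ext
    rw [coe_inv_mul, coe_inv_mul, coe_mul H h, src_mul h]
  range_mul a b h := by
    have h := composable_aux H h
    apply Subtype.ext
    rw [coe_mul_inv, coe_mul_inv, coe_mul H h, rng_mul h]
  assoc a b c h k := by
    have h := composable_aux H h
    have k := composable_aux H k
    apply Subtype.ext
    have h1 : Composable (a * b).1 c.1 := by
      rw [coe_mul H h, Composable, src_mul h]; exact k
    have h2 : Composable a.1 (b * c).1 := by
      rw [coe_mul H k, Composable, rng_mul k]; exact h
    rw [coe_mul H h1, coe_mul H h2, coe_mul H h, coe_mul H k, mul_assoc' h k]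
  inv_mul_cancel_left a b h := by
    have h := composable_aux H h
    apply Subtype.ext
    have h1 : Composable (a⁻¹).1 (a * b).1 := by
      rw [coe_mul H h, coe_inv, Composable, src_inv, rng_mul h]
    rw [coe_mul H h1, coe_mul H h, coe_inv, inv_mul_cancel h]
  mul_inv_cancel_right a b h := by
    have h := composable_aux H h
    apply Subtype.ext
    have h1 : Composable (a * b).1 (b⁻¹).1 := by
      rw [coe_mul H h, coe_inv, Composable, rng_inv, src_mul h]
    rw [coe_mul H h1, coe_mul H h, coe_inv, mul_inv_cancel h]

theorem coe_src (a : H) : (src a).1 = src a.1 := coe_inv_mul H a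

theorem coe_rng (a : H) : (rng a).1 = rng a.1 := coe_mul_inv H a

theorem composable_iff {a b : H} : Composable a b ↔ Composable a.1 b.1 := by
  rw [Composable, Composable, Subtype.ext_iff, coe_src, coe_rng]

theorem mem_units_iff {a : H} : a ∈ units H ↔ a.1 ∈ units G := by
  constructor
  · rintro ⟨b, rfl⟩
    rw [coe_src]
    exact src_mem_units _
  · intro h
    exact ⟨a, Subtype.ext (by rw [coe_src, src_of_mem_units h])⟩

instance [IsTopological G] : IsTopological H where
  continuous_inv := (continuous_inv'.comp continuous_subtype_val).subtype_mk _
  continuousOn_mul := by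
    rw [continuousOn_iff_continuous_domRestrict]
    refine IsEmbedding.subtypeVal.continuous_iff.2 ?_
    have h : ∀ p : {p : H × H | Composable p.1 p.2}, Composable p.1.1.1 p.1.2.1 :=
      fun p => (composable_iff H).1 p.2
    have h2 : Continuous fun p : {p : H × H | Composable p.1 p.2} => p.1.1.1 * p.1.2.1 :=
      continuous_mul_of (by fun_prop) (by fun_prop) h
    refine h2.congr fun p => ?_
    exact (coe_mul H (h p)).symm

theorem isOpenBisection_preimage {B : Set G} (hB : IsOpenBisection B) :
    IsOpenBisection (Subtype.val ⁻¹' B : Set H) := by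
  have hU : IsOpenBisection (B ∩ H.carrier) :=
    hB.mono (hB.isOpen.inter H.isOpen) inter_subset_left
  have e1 : (rng '' (Subtype.val ⁻¹' B) : Set H) = Subtype.val ⁻¹' (rng '' (B ∩ H.carrier)) := by
    ext y
    constructor
    · rintro ⟨x, hx, rfl⟩
      exact ⟨x.1, ⟨hx, x.2⟩, (coe_rng H x).symm⟩
    · rintro ⟨x, hx, hxy⟩
      exact ⟨⟨x, hx.2⟩, hx.1, Subtype.ext (by rw [coe_rng, hxy])⟩
  have e2 : (src '' (Subtype.val ⁻¹' B) : Set H) = Subtype.val ⁻¹' (src '' (B ∩ H.carrier)) := by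
    ext y
    constructor
    · rintro ⟨x, hx, rfl⟩
      exact ⟨x.1, ⟨hx, x.2⟩, (coe_src H x).symm⟩
    · rintro ⟨x, hx, hxy⟩
      exact ⟨⟨x, hx.2⟩, hx.1, Subtype.ext (by rw [coe_src, hxy])⟩
  have hj : IsEmbedding (fun x : (Subtype.val ⁻¹' B : Set H) => (⟨x.1.1, x.2⟩ : B)) :=
    (IsEmbedding.subtypeVal.comp IsEmbedding.subtypeVal).codRestrict B _
  refine ⟨hB.isOpen.preimage continuous_subtype_val, ?_, ?_, ?_, ?_⟩
  · rw [e1]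
    exact hU.isOpen_rng.preimage continuous_subtype_val
  · rw [e2]
    exact hU.isOpen_src.preimage continuous_subtype_val
  · have h := hB.isEmbedding_rng.comp hj
    refine (IsEmbedding.of_comp_iff (IsEmbedding.subtypeVal (p := fun a => a ∈ H.carrier))).1 ?_
    convert h using 1
    funext x
    exact coe_rng H x.1
  · have h := hB.isEmbedding_src.comp hj
    refine (IsEmbedding.of_comp_iff (IsEmbedding.subtypeVal (p := fun a => a ∈ H.carrier))).1 ?_
    convert h using 1
    funext x
    exact coe_src H x.1

instance [IsAmple G] : IsAmple H where
  isTopologicalBasis := by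
    refine TopologicalSpace.isTopologicalBasis_of_isOpen_of_nhds (fun U hU => hU.2.isOpen) ?_
    intro a U haU hU
    have hU' : IsOpen (Subtype.val '' U : Set G) := H.isOpen.isOpenMap_subtype_val U hU
    obtain ⟨B, ⟨hBc, hB⟩, haB, hBU⟩ :=
      (IsAmple.isTopologicalBasis (G := G)).exists_subset_of_mem_open
        (mem_image_of_mem _ haU) hU'
    have hsub : (Subtype.val ⁻¹' B : Set H) ⊆ U := by
      intro x hx
      obtain ⟨y, hy, hyx⟩ := hBU hx
      rwa [← Subtype.ext hyx]
    refine ⟨Subtype.val ⁻¹' B, ⟨?_, isOpenBisection_preimage H hB⟩, haB, hsub⟩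
    rw [Subtype.isCompact_iff, Subtype.image_preimage_coe, inter_eq_right.2]
    · exact hBc
    · intro x hx
      obtain ⟨y, -, rfl⟩ := hBU hx
      exact y.2

end OpenSubgroupoid

end ArrowGroupoid

open ArrowGroupoid

/-! ### Discrete twists -/

/-- A discrete twist `G⁽⁰⁾ × T → S → G` by the discrete group `T`.  Here `S` is the total
groupoid, and `G⁽⁰⁾ × T` is the trivial group bundle, in which `(x, t)` and `(y, t')` are
composable exactly when `x = y`, with product `(x, t * t')`. -/
structure DiscreteTwist (T G S : Type*) [CommGroup T] [TopologicalSpace T] [DiscreteTopology T]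
    [ArrowGroupoid G] [TopologicalSpace G] [ArrowGroupoid S] [TopologicalSpace S] where
  i : units G × T → S
  q : S → G
  continuous_i : Continuous i
  continuous_q : Continuous q
  i_hom : ∀ (x : units G) (t t' : T),
    Composable (i (x, t)) (i (x, t')) ∧ i (x, t * t') = i (x, t) * i (x, t')
  q_hom : IsHom q
  units_eq : units S = Set.range fun x : units G => i (x, 1)
  isEmbedding_i_units : IsEmbedding fun x : units G => i (x, 1)
  isEmbedding_q_units : IsEmbedding ((units S).domRestrict q)
  q_image_units : q '' units S = units G
  /-- Exactness. -/
  range_i_fibre : ∀ x : units G, (Set.range fun t : T => i (x, t)) = q ⁻¹' {x.1}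
  i_injective : Function.Injective i
  q_surjective : Function.Surjective q
  /-- Local triviality: the map is a homeomorphism from `B × T` to `q⁻¹(B)`. -/
  locally_trivial : ∀ a : G, ∃ (B : Set G) (P : B → S), a ∈ B ∧ IsOpenBisection B ∧
    Continuous P ∧ (∀ b : B, q (P b) = b) ∧
    IsEmbedding (fun p : B × T => i (⟨rng p.1.1, rng_mem_units p.1.1⟩, p.2) * P p.1) ∧
    (Set.range fun p : B × T => i (⟨rng p.1.1, rng_mem_units p.1.1⟩, p.2) * P p.1) = q ⁻¹' B
  /-- Centrality. -/
  central : ∀ (σ : S) (t : T),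
    i (⟨rng (q σ), rng_mem_units (q σ)⟩, t) * σ = σ * i (⟨src (q σ), src_mem_units (q σ)⟩, t)

namespace DiscreteTwist

section Basic

variable {T G S : Type*} [CommGroup T] [TopologicalSpace T] [DiscreteTopology T]
  [ArrowGroupoid G] [TopologicalSpace G] [ArrowGroupoid S] [TopologicalSpace S]
  (tw : DiscreteTwist T G S)

/-- The action `t · σ = i(r(σ), t) σ` of `T` on the total groupoid. -/
def act (t : T) (σ : S) : S := tw.i (⟨rng (tw.q σ), rng_mem_units (tw.q σ)⟩, t) * σ

theorem q_i (x : units G) (t : T) : tw.q (tw.i (x, t)) = x.1 := by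
  have : tw.i (x, t) ∈ tw.q ⁻¹' {x.1} := by
    rw [← tw.range_i_fibre x]
    exact ⟨t, rfl⟩
  exact this

theorem i_one_mem_units (x : units G) : tw.i (x, 1) ∈ units S := by
  rw [tw.units_eq]
  exact ⟨x, rfl⟩

theorem units_ext {σ τ : S} (hσ : σ ∈ units S) (hτ : τ ∈ units S) (h : tw.q σ = tw.q τ) :
    σ = τ := by
  have := tw.isEmbedding_q_units.injective (a₁ := ⟨σ, hσ⟩) (a₂ := ⟨τ, hτ⟩) h
  exact congrArg Subtype.val this

theorem i_one (σ : S) : tw.i (⟨rng (tw.q σ), rng_mem_units (tw.q σ)⟩, 1) = rng σ := by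
  refine tw.units_ext (tw.i_one_mem_units _) (rng_mem_units _) ?_
  rw [tw.q_i, tw.q_hom.map_rng]

theorem rng_i (x : units G) (t : T) : rng (tw.i (x, t)) = tw.i (x, 1) := by
  refine tw.units_ext (rng_mem_units _) (tw.i_one_mem_units _) ?_
  rw [tw.q_hom.map_rng, tw.q_i, tw.q_i, rng_of_mem_units x.2]

theorem src_i (x : units G) (t : T) : src (tw.i (x, t)) = tw.i (x, 1) := by
  refine tw.units_ext (src_mem_units _) (tw.i_one_mem_units _) ?_
  rw [tw.q_hom.map_src, tw.q_i, tw.q_i, src_of_mem_units x.2]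

theorem act_composable (t : T) (σ : S) :
    Composable (tw.i (⟨rng (tw.q σ), rng_mem_units (tw.q σ)⟩, t)) σ := by
  rw [Composable, tw.src_i, tw.i_one]

theorem q_act (t : T) (σ : S) : tw.q (tw.act t σ) = tw.q σ := by
  rw [act, tw.q_hom.map_mul (tw.act_composable t σ), tw.q_i, rng_mul_self]

theorem rng_act (t : T) (σ : S) : rng (tw.act t σ) = rng σ := by
  rw [act, rng_mul (tw.act_composable t σ), tw.rng_i, tw.i_one]

theorem src_act (t : T) (σ : S) : src (tw.act t σ) = src σ := by
  rw [act, src_mul (tw.act_composable t σ)]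

theorem act_mul_left (t : T) {σ τ : S} (h : Composable σ τ) :
    tw.act t σ * τ = tw.act t (σ * τ) := by
  have hx : rng (tw.q (σ * τ)) = rng (tw.q σ) := by
    rw [tw.q_hom.map_mul h, rng_mul (tw.q_hom.composable h)]
  simp only [act, hx]
  exact mul_assoc' (tw.act_composable t σ) h

theorem act_mul_right (t : T) {σ τ : S} (h : Composable σ τ) :
    σ * tw.act t τ = tw.act t (σ * τ) := by
  have hc : Composable (tw.q σ) (tw.q τ) := tw.q_hom.composable h
  have hx : src (tw.q σ) = rng (tw.q τ) := hc
  have h1 : Composable σ (tw.i (⟨src (tw.q σ), src_mem_units _⟩, t)) := by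
    simp only [Composable, hx, tw.rng_i, tw.i_one]
    exact h
  rw [← tw.act_mul_left t h, act, act, tw.central σ t, mul_assoc' h1]
  · simp only [hx]
  · simp only [hx]
    exact tw.act_composable t τ

theorem act_act (s t : T) (σ : S) : tw.act s (tw.act t σ) = tw.act (s * t) σ := by
  have h := tw.i_hom ⟨rng (tw.q σ), rng_mem_units (tw.q σ)⟩ s t
  have e : tw.act s (tw.act t σ) =
      tw.i (⟨rng (tw.q σ), rng_mem_units (tw.q σ)⟩, s) * tw.act t σ := by
    simp only [act.eq_1 tw s, tw.q_act]
  rw [e, act, act, h.2, mul_assoc' h.1 (tw.act_composable t σ)]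

theorem act_one (σ : S) : tw.act 1 σ = σ := by
  rw [act, tw.i_one, rng_mul_self]

theorem act_inv (t : T) (σ : S) : (tw.act t σ)⁻¹ = tw.act t⁻¹ σ⁻¹ := by
  have h1 : Composable (tw.act t σ) (tw.act t⁻¹ σ⁻¹) := by
    rw [Composable, src_act, rng_act, rng_inv]
  refine mul_left_cancel' (composable_inv_right _) h1 ?_
  have h2 : Composable σ (tw.act t⁻¹ σ⁻¹) := by
    rw [Composable, rng_act, rng_inv]
  rw [tw.act_mul_left t h2, tw.act_mul_right t⁻¹ (composable_inv_right σ), tw.act_act,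
    _root_.mul_inv_cancel t, tw.act_one]
  exact tw.rng_act t σ

theorem exists_act {σ τ : S} (h : tw.q σ = tw.q τ) : ∃ t : T, τ = tw.act t σ := by
  have hs : src τ = src σ := by
    refine tw.units_ext (src_mem_units _) (src_mem_units _) ?_
    rw [tw.q_hom.map_src, tw.q_hom.map_src, h]
  have hc : Composable τ σ⁻¹ := by rw [Composable, rng_inv, hs]
  have hq : tw.q (τ * σ⁻¹) = rng (tw.q σ) := by
    rw [tw.q_hom.map_mul hc, tw.q_hom.map_inv, h]
    rfl
  have hm : τ * σ⁻¹ ∈ tw.q ⁻¹' {(⟨rng (tw.q σ), rng_mem_units _⟩ : units G).1} := hq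
  rw [← tw.range_i_fibre] at hm
  obtain ⟨t, ht⟩ := hm
  refine ⟨t, ?_⟩
  have ht' : tw.i (⟨rng (tw.q σ), rng_mem_units (tw.q σ)⟩, t) = τ * σ⁻¹ := ht
  rw [act, ht', mul_assoc' hc (composable_inv_left σ)]
  change τ = τ * src σ
  rw [← hs, mul_src]

/-- The preimage of an open subgroupoid of `G` in the total groupoid. -/
def preimage (H : OpenSubgroupoid G) : OpenSubgroupoid S where
  carrier := tw.q ⁻¹' H.carrier
  isOpen := H.isOpen.preimage tw.continuous_q
  mul_mem {a b} ha hb h := by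
    change tw.q (a * b) ∈ H.carrier
    rw [tw.q_hom.map_mul h]
    exact H.mul_mem ha hb (tw.q_hom.composable h)
  inv_mem {a} ha := by
    change tw.q a⁻¹ ∈ H.carrier
    rw [tw.q_hom.map_inv]
    exact H.inv_mem ha

/-- The inclusion of unit spaces of an open subgroupoid. -/
def unitsIncl (H : OpenSubgroupoid G) (x : units H) : units G :=
  ⟨x.1.1, (H.mem_units_iff).1 x.2⟩

theorem isEmbedding_unitsIncl (H : OpenSubgroupoid G) : IsEmbedding (unitsIncl H) :=
  (IsEmbedding.subtypeVal.comp IsEmbedding.subtypeVal).codRestrict _ _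

theorem i_mem_preimage (H : OpenSubgroupoid G) (x : units H) (t : T) :
    tw.i (unitsIncl H x, t) ∈ (tw.preimage H).carrier := by
  change tw.q (tw.i _) ∈ H.carrier
  rw [tw.q_i]
  exact x.1.2

/-- The restriction of the map `i` to an open subgroupoid. -/
def restrictI (H : OpenSubgroupoid G) (p : units H × T) : tw.preimage H :=
  ⟨tw.i (unitsIncl H p.1, p.2), tw.i_mem_preimage H p.1 p.2⟩

/-- The restriction of the map `q` to an open subgroupoid. -/
def restrictQ (H : OpenSubgroupoid G) (σ : tw.preimage H) : H := ⟨tw.q σ.1, σ.2⟩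

/-- The restriction of the maps `i` and `q` to an open subgroupoid `H` of `G` and to its
preimage in the total groupoid gives a discrete twist over `H`. -/
noncomputable def restrict (H : OpenSubgroupoid G) : DiscreteTwist T H (tw.preimage H) where
  i := tw.restrictI H
  q := tw.restrictQ H
  continuous_i := (tw.continuous_i.comp
    (((isEmbedding_unitsIncl H).continuous.comp continuous_fst).prodMk
      continuous_snd)).subtype_mk _
  continuous_q := (tw.continuous_q.comp continuous_subtype_val).subtype_mk _
  i_hom x t t' := by
    have h := tw.i_hom (unitsIncl H x) t t'
    refine ⟨(OpenSubgroupoid.composable_iff _).2 h.1, Subtype.ext ?_⟩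
    rw [OpenSubgroupoid.coe_mul _ (by exact h.1)]
    exact h.2
  q_hom a b h := by
    have h := (OpenSubgroupoid.composable_iff _).1 h
    have h' := tw.q_hom.composable h
    refine ⟨(OpenSubgroupoid.composable_iff _).2 h', Subtype.ext ?_⟩
    rw [OpenSubgroupoid.coe_mul _ (by exact h')]
    change tw.q (a * b : tw.preimage H).1 = _
    rw [OpenSubgroupoid.coe_mul _ h]
    exact tw.q_hom.map_mul h
  units_eq := by
    ext σ
    rw [OpenSubgroupoid.mem_units_iff, tw.units_eq]
    constructor
    · rintro ⟨x, hx⟩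
      have hx' : tw.i (x, 1) = σ.1 := hx
      have hxH : x.1 ∈ H.carrier := by
        have h := σ.2
        rw [← hx'] at h
        change tw.q (tw.i _) ∈ H.carrier at h
        rwa [tw.q_i] at h
      exact ⟨⟨⟨x.1, hxH⟩, (H.mem_units_iff).2 x.2⟩, Subtype.ext hx'⟩
    · rintro ⟨x, rfl⟩
      exact ⟨unitsIncl H x, rfl⟩
  isEmbedding_i_units :=
    (tw.isEmbedding_i_units.comp (isEmbedding_unitsIncl H)).codRestrict _ _
  isEmbedding_q_units :=
    (tw.isEmbedding_q_units.comp (isEmbedding_unitsIncl (tw.preimage H))).codRestrict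
      H.carrier (fun x => x.1.2)
  q_image_units := by
    ext x
    constructor
    · rintro ⟨σ, hσ, rfl⟩
      rw [OpenSubgroupoid.mem_units_iff] at hσ ⊢
      rw [← tw.q_image_units]
      exact ⟨σ.1, hσ, rfl⟩
    · intro hx
      have hx' := (H.mem_units_iff).1 hx
      rw [← tw.q_image_units] at hx'
      obtain ⟨σ, hσ, hσx⟩ := hx'
      have hm : σ ∈ (tw.preimage H).carrier := by
        change tw.q σ ∈ H.carrier
        rw [hσx]
        exact x.2
      exact ⟨⟨σ, hm⟩, (OpenSubgroupoid.mem_units_iff _).2 hσ, Subtype.ext hσx⟩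
  range_i_fibre x := by
    ext σ
    have h := Set.ext_iff.1 (tw.range_i_fibre (unitsIncl H x)) σ.1
    constructor
    · rintro ⟨t, rfl⟩
      exact Subtype.ext (tw.q_i _ _)
    · intro hσ
      obtain ⟨t, ht⟩ := h.2 (congrArg Subtype.val hσ)
      exact ⟨t, Subtype.ext ht⟩
  i_injective := by
    rintro ⟨x, t⟩ ⟨y, s⟩ h
    have h' := tw.i_injective (congrArg Subtype.val h)
    have h1 := congrArg Prod.fst h'
    have h2 := congrArg Prod.snd h'
    exact Prod.ext ((isEmbedding_unitsIncl H).injective h1) h2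
  q_surjective x := by
    obtain ⟨σ, hσ⟩ := tw.q_surjective x.1
    refine ⟨⟨σ, ?_⟩, Subtype.ext hσ⟩
    change tw.q σ ∈ H.carrier
    rw [hσ]
    exact x.2
  locally_trivial a := by
    obtain ⟨B, P, haB, hB, hP, hqP, he, hr⟩ := tw.locally_trivial a.1
    have hPm : ∀ b : (Subtype.val ⁻¹' B : Set H), P ⟨b.1.1, b.2⟩ ∈ (tw.preimage H).carrier := by
      intro b
      change tw.q (P _) ∈ H.carrier
      rw [hqP]
      exact b.1.2
    have hj : IsEmbedding (fun b : (Subtype.val ⁻¹' B : Set H) => (⟨b.1.1, b.2⟩ : B)) :=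
      (IsEmbedding.subtypeVal.comp IsEmbedding.subtypeVal).codRestrict B _
    have hcomp : ∀ (b : B) (t : T),
        Composable (tw.i (⟨rng b.1, rng_mem_units b.1⟩, t)) (P b) := by
      intro b t
      have := tw.act_composable t (P b)
      simpa only [hqP] using this
    have hval : ∀ p : (Subtype.val ⁻¹' B : Set H) × T,
        (tw.restrictI H (⟨rng p.1.1, rng_mem_units p.1.1⟩, p.2) *
          ⟨P ⟨p.1.1.1, p.1.2⟩, hPm p.1⟩).1 =
        tw.i (⟨rng p.1.1.1, rng_mem_units p.1.1.1⟩, p.2) * P ⟨p.1.1.1, p.1.2⟩ := by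
      intro p
      have hu : unitsIncl H ⟨rng p.1.1, rng_mem_units p.1.1⟩ =
          ⟨rng p.1.1.1, rng_mem_units p.1.1.1⟩ := Subtype.ext (H.coe_rng p.1.1)
      rw [OpenSubgroupoid.coe_mul]
      · simp only [restrictI, hu]
      · simp only [restrictI, hu]
        exact hcomp ⟨p.1.1.1, p.1.2⟩ p.2
    refine ⟨Subtype.val ⁻¹' B, fun b => ⟨P ⟨b.1.1, b.2⟩, hPm b⟩, haB,
      H.isOpenBisection_preimage hB, (hP.comp hj.continuous).subtype_mk _,
      fun b => Subtype.ext (hqP _), ?_, ?_⟩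
    · refine (IsEmbedding.of_comp_iff
        (IsEmbedding.subtypeVal (p := fun a => a ∈ (tw.preimage H).carrier))).1 ?_
      have h := he.comp (hj.prodMap (IsEmbedding.id (X := T)))
      convert h using 1
      funext p
      exact hval p
    · ext σ
      constructor
      · rintro ⟨p, rfl⟩
        have h : (tw.i (⟨rng p.1.1.1, rng_mem_units p.1.1.1⟩, p.2) * P ⟨p.1.1.1, p.1.2⟩) ∈
            tw.q ⁻¹' B := by
          rw [← hr]
          exact ⟨(⟨p.1.1.1, p.1.2⟩, p.2), rfl⟩
        rw [← hval p] at h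
        exact h
      · intro hσ
        have hσ' : σ.1 ∈ tw.q ⁻¹' B := hσ
        rw [← hr] at hσ'
        obtain ⟨⟨b, t⟩, hb⟩ := hσ'
        have hb' : tw.i (⟨rng b.1, rng_mem_units b.1⟩, t) * P b = σ.1 := hb
        have hbH : b.1 ∈ H.carrier := by
          have h : tw.q σ.1 ∈ H.carrier := σ.2
          rwa [← hb', tw.q_hom.map_mul (hcomp b t), tw.q_i, hqP, rng_mul_self] at h
        refine ⟨(⟨⟨b.1, hbH⟩, b.2⟩, t), Subtype.ext ?_⟩
        rw [← hb']
        exact hval (⟨⟨b.1, hbH⟩, b.2⟩, t)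
  central σ t := by
    have h1 := tw.act_composable t σ.1
    have h2 : Composable σ.1 (tw.i (⟨src (tw.q σ.1), src_mem_units (tw.q σ.1)⟩, t)) := by
      rw [Composable, tw.rng_i]
      refine tw.units_ext (src_mem_units _) (tw.i_one_mem_units _) ?_
      rw [tw.q_hom.map_src, tw.q_i]
    have e1 : unitsIncl H ⟨rng (⟨tw.q σ.1, σ.2⟩ : H), rng_mem_units _⟩ =
        ⟨rng (tw.q σ.1), rng_mem_units (tw.q σ.1)⟩ := Subtype.ext (H.coe_rng _)
    have e2 : unitsIncl H ⟨src (⟨tw.q σ.1, σ.2⟩ : H), src_mem_units _⟩ =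
        ⟨src (tw.q σ.1), src_mem_units (tw.q σ.1)⟩ := Subtype.ext (H.coe_src _)
    apply Subtype.ext
    rw [OpenSubgroupoid.coe_mul, OpenSubgroupoid.coe_mul]
    · simp only [restrictI, restrictQ, e1, e2]
      exact tw.central σ.1 t
    · simp only [restrictI, restrictQ, e2]
      exact h2
    · simp only [restrictI, restrictQ, e1]
      exact h1

end Basic

end DiscreteTwist

/-! ### Twisted Steinberg algebras -/

namespace DiscreteTwist

section Steinberg

variable {R G S : Type*} [CommRing R] [TopologicalSpace Rˣ] [DiscreteTopology Rˣ]
  [ArrowGroupoid G] [TopologicalSpace G] [ArrowGroupoid S] [TopologicalSpace S]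
  (tw : DiscreteTwist Rˣ G S)

/-- `Rˣ`-contravariant functions. -/
def IsContravariant (f : S → R) : Prop :=
  ∀ (t : Rˣ) (σ : S), f (tw.act t σ) = (↑t⁻¹ : R) * f σ

/-- The image in `G` of the support of a function on the total groupoid. -/
def suppG (f : S → R) : Set G := tw.q '' {σ | f σ ≠ 0}

/-- A (not necessarily continuous) section of the quotient map. -/
noncomputable def sec (a : G) : S := Function.surjInv tw.q_surjective a

theorem q_sec (a : G) : tw.q (tw.sec a) = a := Function.surjInv_eq tw.q_surjective a

/-- The twisted convolution product. -/
noncomputable def conv (f g : S → R) (σ : S) : R :=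
  ∑ᶠ a ∈ {a : G | rng a = rng (tw.q σ)} ∩ tw.suppG f, f (tw.sec a) * g ((tw.sec a)⁻¹ * σ)

variable {tw} {f g h : S → R}

theorem IsContravariant.ne_zero_iff (hf : tw.IsContravariant f) {σ τ : S}
    (e : tw.q σ = tw.q τ) : f τ ≠ 0 ↔ f σ ≠ 0 := by
  obtain ⟨t, rfl⟩ := tw.exists_act e
  rw [hf]
  simp

theorem IsContravariant.mem_suppG_iff (hf : tw.IsContravariant f) (σ : S) :
    tw.q σ ∈ tw.suppG f ↔ f σ ≠ 0 := by
  constructor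
  · rintro ⟨τ, hτ, e⟩
    exact (hf.ne_zero_iff e).2 hτ
  · intro h
    exact ⟨σ, h, rfl⟩

theorem isClopen_suppG (hf : tw.IsContravariant f) (hl : IsLocallyConstant f) :
    IsClopen (tw.suppG f) := by
  have key : ∀ a : G, ∀ᶠ b in 𝓝 a, (b ∈ tw.suppG f ↔ a ∈ tw.suppG f) := by
    intro a
    obtain ⟨B, P, haB, hB, hP, hqP, -, -⟩ := tw.locally_trivial a
    have h1 : IsLocallyConstant (f ∘ P) := hl.comp_continuous hP
    have h2 : ∀ᶠ b : B in 𝓝 ⟨a, haB⟩, f (P b) = f (P ⟨a, haB⟩) := h1.eventually_eq _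
    rw [nhds_subtype_eq_comap, Filter.eventually_comap] at h2
    filter_upwards [h2, hB.isOpen.mem_nhds haB] with b hb hbB
    have e1 := hf.mem_suppG_iff (P ⟨b, hbB⟩)
    have e2 := hf.mem_suppG_iff (P ⟨a, haB⟩)
    rw [hqP] at e1 e2
    rw [e1, e2, hb ⟨b, hbB⟩ rfl]
  refine ⟨⟨?_⟩, ?_⟩
  · rw [isOpen_iff_mem_nhds]
    intro a ha
    filter_upwards [key a] with b hb
    exact fun h => ha (hb.1 h)
  · rw [isOpen_iff_mem_nhds]
    intro a ha
    filter_upwards [key a] with b hb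
    exact hb.2 ha

theorem conv_term_eq (hf : tw.IsContravariant f) (hg : tw.IsContravariant g) {σ τ τ' : S}
    (e : tw.q τ = tw.q τ') (hr : rng (tw.q τ) = rng (tw.q σ)) :
    f τ' * g (τ'⁻¹ * σ) = f τ * g (τ⁻¹ * σ) := by
  obtain ⟨t, rfl⟩ := tw.exists_act e
  have hc : Composable τ⁻¹ σ := by
    rw [Composable, src_inv]
    refine tw.units_ext (rng_mem_units _) (rng_mem_units _) ?_
    rw [tw.q_hom.map_rng, tw.q_hom.map_rng, hr]
  rw [tw.act_inv, tw.act_mul_left _ hc, hf, hg]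
  have : (↑t⁻¹ : R) * (↑(t⁻¹)⁻¹ : R) = 1 := by simp
  calc (↑t⁻¹ : R) * f τ * ((↑(t⁻¹)⁻¹ : R) * g (τ⁻¹ * σ))
      = ((↑t⁻¹ : R) * (↑(t⁻¹)⁻¹ : R)) * (f τ * g (τ⁻¹ * σ)) := by ring
    _ = _ := by rw [this, one_mul]

/-- The convolution as a finite sum, for any choice of representatives of the arrows in the
support of the first function. -/
theorem conv_eq_sum {ι : Type*} (hf : tw.IsContravariant f) (hg : tw.IsContravariant g) {σ : S}
    (F : Finset ι) (τ : ι → S) (h1 : ∀ a ∈ F, rng (tw.q (τ a)) = rng (tw.q σ))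
    (h2 : ∀ a ∈ F, ∀ b ∈ F, tw.q (τ a) = tw.q (τ b) → a = b)
    (h3 : ∀ ρ : S, rng (tw.q ρ) = rng (tw.q σ) → f ρ ≠ 0 → g (ρ⁻¹ * σ) ≠ 0 →
      ∃ a ∈ F, tw.q (τ a) = tw.q ρ) :
    tw.conv f g σ = ∑ a ∈ F, f (τ a) * g ((τ a)⁻¹ * σ) := by
  classical
  have e1 : ∑ a ∈ F, f (τ a) * g ((τ a)⁻¹ * σ) =
      ∑ b ∈ F.image (fun a => tw.q (τ a)), f (tw.sec b) * g ((tw.sec b)⁻¹ * σ) := by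
    rw [Finset.sum_image h2]
    refine Finset.sum_congr rfl fun a ha => ?_
    exact conv_term_eq hf hg (tw.q_sec _) (by rw [tw.q_sec, h1 a ha])
  rw [e1, conv]
  refine finsum_mem_eq_sum_of_inter_support_eq _ ?_
  ext b
  simp only [mem_inter_iff, mem_ofPred_eq, Function.mem_support, Finset.coe_image, mem_image,
    Finset.mem_coe]
  constructor
  · rintro ⟨⟨hb, -⟩, hne⟩
    refine ⟨?_, hne⟩
    have := h3 (tw.sec b) (by rw [tw.q_sec, hb]) (left_ne_zero_of_mul hne)
      (right_ne_zero_of_mul hne)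
    rwa [tw.q_sec] at this
  · rintro ⟨⟨a, ha, rfl⟩, hne⟩
    refine ⟨⟨h1 a ha, ?_⟩, hne⟩
    have := hf.mem_suppG_iff (tw.sec (tw.q (τ a)))
    rw [tw.q_sec] at this
    exact this.2 (left_ne_zero_of_mul hne)

theorem exists_of_conv_ne_zero {σ : S} (hne : tw.conv f g σ ≠ 0) :
    ∃ τ : S, rng (tw.q τ) = rng (tw.q σ) ∧ f τ ≠ 0 ∧ g (τ⁻¹ * σ) ≠ 0 := by
  by_contra hcon
  push Not at hcon
  refine hne (finsum_mem_eq_zero_of_forall_eq_zero ?_)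
  rintro a ⟨ha, -⟩
  by_cases hfa : f (tw.sec a) = 0
  · rw [hfa, zero_mul]
  · rw [hcon (tw.sec a) (by rw [tw.q_sec]; exact ha) hfa, mul_zero]

theorem composable_inv_of_rng (tw : DiscreteTwist Rˣ G S) {σ τ : S}
    (hr : rng (tw.q τ) = rng (tw.q σ)) : Composable τ⁻¹ σ := by
  rw [Composable, src_inv]
  refine tw.units_ext (rng_mem_units _) (rng_mem_units _) ?_
  rw [tw.q_hom.map_rng, tw.q_hom.map_rng, hr]

theorem rng_of_rng_q (tw : DiscreteTwist Rˣ G S) {σ τ : S}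
    (hr : rng (tw.q τ) = rng (tw.q σ)) : rng τ = rng σ := by
  rw [← src_inv]
  exact tw.composable_inv_of_rng hr

theorem exists_mul_of_conv_ne_zero {σ : S} (hne : tw.conv f g σ ≠ 0) :
    ∃ a ∈ tw.suppG f, ∃ b ∈ tw.suppG g, Composable a b ∧ tw.q σ = a * b := by
  obtain ⟨τ, hr, hf, hg⟩ := exists_of_conv_ne_zero hne
  have hc := tw.composable_inv_of_rng hr
  have hc2 : Composable τ (τ⁻¹ * σ) := by rw [Composable, rng_mul hc, rng_inv]
  refine ⟨tw.q τ, ⟨τ, hf, rfl⟩, tw.q (τ⁻¹ * σ), ⟨_, hg, rfl⟩, tw.q_hom.composable hc2, ?_⟩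
  rw [← tw.q_hom.map_mul hc2, mul_inv_mul (tw.rng_of_rng_q hr)]

/-- The convolution as a finite sum over any finite set of arrows that contains the support
of the first function. -/
theorem conv_eq_sum_sec (hf : tw.IsContravariant f) (hg : tw.IsContravariant g) {σ : S}
    (F : Finset G) (h1 : ∀ a ∈ F, rng a = rng (tw.q σ))
    (h2 : ∀ a, rng a = rng (tw.q σ) → a ∈ tw.suppG f → a ∈ F) :
    tw.conv f g σ = ∑ a ∈ F, f (tw.sec a) * g ((tw.sec a)⁻¹ * σ) := by
  refine conv_eq_sum hf hg F tw.sec (fun a ha => by rw [tw.q_sec, h1 a ha]) ?_ ?_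
  · intro a _ b _ h
    simpa only [tw.q_sec] using h
  · intro ρ hρ hne _
    exact ⟨tw.q ρ, h2 _ hρ ⟨ρ, hne, rfl⟩, tw.q_sec _⟩

theorem suppG_add_subset (f g : S → R) : tw.suppG (f + g) ⊆ tw.suppG f ∪ tw.suppG g := by
  rintro _ ⟨σ, hσ, rfl⟩
  by_cases hf : f σ = 0
  · right
    refine ⟨σ, ?_, rfl⟩
    intro hg
    exact hσ (by simp [hf, hg])
  · left
    exact ⟨σ, hf, rfl⟩

theorem IsContravariant.add (hf : tw.IsContravariant f) (hg : tw.IsContravariant g) :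
    tw.IsContravariant (f + g) := by
  intro t σ
  simp only [Pi.add_apply, hf t σ, hg t σ, mul_add]

theorem IsContravariant.smul (hf : tw.IsContravariant f) (r : R) :
    tw.IsContravariant (r • f) := by
  intro t σ
  simp only [Pi.smul_apply, hf t σ, smul_eq_mul]
  ring

section Ample

variable [IsAmple G]

variable (tw) in
/-- The finite set of arrows of the support of `f` with the same range as `σ`. -/
noncomputable def fibre (hf : IsCompact (tw.suppG f)) (σ : S) : Finset G :=
  (finite_fibre_inter hf (rng (tw.q σ))).toFinset

theorem mem_fibre (hf : IsCompact (tw.suppG f)) {σ : S} {a : G} :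
    a ∈ tw.fibre hf σ ↔ rng a = rng (tw.q σ) ∧ a ∈ tw.suppG f := by
  simp [fibre]

theorem conv_contravariant (hf : tw.IsContravariant f) (hg : tw.IsContravariant g)
    (cf : IsCompact (tw.suppG f)) : tw.IsContravariant (tw.conv f g) := by
  intro t σ
  have hF1 : ∀ a ∈ tw.fibre cf σ, rng a = rng (tw.q σ) := fun a ha => ((mem_fibre cf).1 ha).1
  have hF2 : ∀ a, rng a = rng (tw.q σ) → a ∈ tw.suppG f → a ∈ tw.fibre cf σ :=
    fun a ha h => (mem_fibre cf).2 ⟨ha, h⟩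
  rw [conv_eq_sum_sec hf hg _ hF1 hF2,
    conv_eq_sum_sec (σ := tw.act t σ) hf hg (tw.fibre cf σ) (by simpa only [tw.q_act] using hF1)
      (by simpa only [tw.q_act] using hF2), Finset.mul_sum]
  refine Finset.sum_congr rfl fun a ha => ?_
  rw [tw.act_mul_right t (tw.composable_inv_of_rng (by rw [tw.q_sec, hF1 a ha])), hg]
  ring

theorem conv_add_left (hf : tw.IsContravariant f) (hg : tw.IsContravariant g)
    (hh : tw.IsContravariant h) (cf : IsCompact (tw.suppG f)) (cg : IsCompact (tw.suppG g)) :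
    tw.conv (f + g) h = tw.conv f h + tw.conv g h := by
  classical
  funext σ
  have hF1 : ∀ a ∈ tw.fibre cf σ ∪ tw.fibre cg σ, rng a = rng (tw.q σ) := by
    intro a ha
    rw [Finset.mem_union, mem_fibre, mem_fibre] at ha
    rcases ha with ha | ha
    · exact ha.1
    · exact ha.1
  have hF2 : ∀ a, rng a = rng (tw.q σ) → a ∈ tw.suppG f →
      a ∈ tw.fibre cf σ ∪ tw.fibre cg σ := fun a ha h =>
    Finset.mem_union_left _ ((mem_fibre cf).2 ⟨ha, h⟩)
  have hF3 : ∀ a, rng a = rng (tw.q σ) → a ∈ tw.suppG g →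
      a ∈ tw.fibre cf σ ∪ tw.fibre cg σ := fun a ha h =>
    Finset.mem_union_right _ ((mem_fibre cg).2 ⟨ha, h⟩)
  rw [Pi.add_apply, conv_eq_sum_sec hf hh _ hF1 hF2, conv_eq_sum_sec hg hh _ hF1 hF3,
    conv_eq_sum_sec (hf.add hg) hh _ hF1, ← Finset.sum_add_distrib]
  · simp only [Pi.add_apply, add_mul]
  · intro a ha h
    rcases suppG_add_subset f g h with h | h
    · exact hF2 a ha h
    · exact hF3 a ha h

theorem conv_add_right (hf : tw.IsContravariant f) (hg : tw.IsContravariant g)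
    (hh : tw.IsContravariant h) (cf : IsCompact (tw.suppG f)) :
    tw.conv f (g + h) = tw.conv f g + tw.conv f h := by
  funext σ
  have hF1 : ∀ a ∈ tw.fibre cf σ, rng a = rng (tw.q σ) := fun a ha => ((mem_fibre cf).1 ha).1
  have hF2 : ∀ a, rng a = rng (tw.q σ) → a ∈ tw.suppG f → a ∈ tw.fibre cf σ :=
    fun a ha h => (mem_fibre cf).2 ⟨ha, h⟩
  rw [Pi.add_apply, conv_eq_sum_sec hf hg _ hF1 hF2, conv_eq_sum_sec hf hh _ hF1 hF2,
    conv_eq_sum_sec hf (hg.add hh) _ hF1 hF2, ← Finset.sum_add_distrib]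
  simp only [Pi.add_apply, mul_add]

theorem conv_smul_left (hf : tw.IsContravariant f) (hg : tw.IsContravariant g)
    (cf : IsCompact (tw.suppG f)) (r : R) : tw.conv (r • f) g = r • tw.conv f g := by
  funext σ
  have hF1 : ∀ a ∈ tw.fibre cf σ, rng a = rng (tw.q σ) := fun a ha => ((mem_fibre cf).1 ha).1
  have hF2 : ∀ a, rng a = rng (tw.q σ) → a ∈ tw.suppG f → a ∈ tw.fibre cf σ :=
    fun a ha h => (mem_fibre cf).2 ⟨ha, h⟩
  rw [Pi.smul_apply, conv_eq_sum_sec hf hg _ hF1 hF2, conv_eq_sum_sec (hf.smul r) hg _ hF1,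
    Finset.smul_sum]
  · simp only [Pi.smul_apply, smul_eq_mul, mul_assoc]
  · rintro a ha ⟨σ', hσ', rfl⟩
    refine hF2 _ ha ⟨σ', ?_, rfl⟩
    intro h0
    exact hσ' (by simp [h0])

theorem conv_smul_right (hf : tw.IsContravariant f) (hg : tw.IsContravariant g)
    (cf : IsCompact (tw.suppG f)) (r : R) : tw.conv f (r • g) = r • tw.conv f g := by
  funext σ
  have hF1 : ∀ a ∈ tw.fibre cf σ, rng a = rng (tw.q σ) := fun a ha => ((mem_fibre cf).1 ha).1
  have hF2 : ∀ a, rng a = rng (tw.q σ) → a ∈ tw.suppG f → a ∈ tw.fibre cf σ :=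
    fun a ha h => (mem_fibre cf).2 ⟨ha, h⟩
  rw [Pi.smul_apply, conv_eq_sum_sec hf hg _ hF1 hF2, conv_eq_sum_sec hf (hg.smul r) _ hF1 hF2,
    Finset.smul_sum]
  refine Finset.sum_congr rfl fun a _ => ?_
  simp only [Pi.smul_apply, smul_eq_mul]
  ring

theorem conv_assoc (hf : tw.IsContravariant f) (hg : tw.IsContravariant g)
    (hh : tw.IsContravariant h) (cf : IsCompact (tw.suppG f)) (cg : IsCompact (tw.suppG g)) :
    tw.conv (tw.conv f g) h = tw.conv f (tw.conv g h) := by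
  classical
  funext σ
  set Fb := tw.fibre cf σ with hFb
  have hb1 : ∀ b ∈ Fb, rng b = rng (tw.q σ) := fun a ha => ((mem_fibre cf).1 ha).1
  have hb2 : ∀ a, rng a = rng (tw.q σ) → a ∈ tw.suppG f → a ∈ Fb :=
    fun a ha h => (mem_fibre cf).2 ⟨ha, h⟩
  set Fa : Finset G := Fb.biUnion fun b =>
    (tw.fibre cg ((tw.sec b)⁻¹)).image fun c => b * c with hFa
  have hfc : ∀ {b c : G}, c ∈ tw.fibre cg ((tw.sec b)⁻¹) → Composable b c := by
    intro b c hc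
    have := ((mem_fibre cg).1 hc).1
    rw [tw.q_hom.map_inv, tw.q_sec, rng_inv] at this
    exact this.symm
  have ha1 : ∀ a ∈ Fa, rng a = rng (tw.q σ) := by
    intro a ha
    simp only [hFa, Finset.mem_biUnion, Finset.mem_image] at ha
    obtain ⟨b, hb, c, hc, rfl⟩ := ha
    rw [rng_mul (hfc hc), hb1 b hb]
  have ha2 : ∀ b c : G, rng b = rng (tw.q σ) → b ∈ tw.suppG f → c ∈ tw.suppG g →
      Composable b c → b * c ∈ Fa := by
    intro b c hb hbf hcg hbc
    simp only [hFa, Finset.mem_biUnion, Finset.mem_image]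
    refine ⟨b, hb2 b hb hbf, c, (mem_fibre cg).2 ⟨?_, hcg⟩, rfl⟩
    rw [tw.q_hom.map_inv, tw.q_sec, rng_inv]
    exact hbc.symm
  have hfg : tw.IsContravariant (tw.conv f g) := conv_contravariant hf hg cf
  have hgh : tw.IsContravariant (tw.conv g h) := conv_contravariant hg hh cg
  have L : tw.conv (tw.conv f g) h σ =
      ∑ a ∈ Fa, (∑ b ∈ Fb, f (tw.sec b) * g ((tw.sec b)⁻¹ * tw.sec a)) *
        h ((tw.sec a)⁻¹ * σ) := by
    rw [conv_eq_sum_sec hfg hh Fa ha1]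
    · refine Finset.sum_congr rfl fun a ha => ?_
      rw [conv_eq_sum_sec hf hg Fb]
      · intro b hb
        rw [hb1 b hb, tw.q_sec, ha1 a ha]
      · intro b hb hbf
        refine hb2 b ?_ hbf
        rw [hb, tw.q_sec, ha1 a ha]
    · rintro _ ha ⟨ρ, hρ, rfl⟩
      obtain ⟨b, hb, c, hc, hbc, e⟩ := exists_mul_of_conv_ne_zero hρ
      rw [e] at ha ⊢
      rw [rng_mul hbc] at ha
      exact ha2 b c ha hb hc hbc
  have M : ∀ b ∈ Fb, tw.conv g h ((tw.sec b)⁻¹ * σ) =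
      ∑ a ∈ Fa, g ((tw.sec b)⁻¹ * tw.sec a) * h ((tw.sec a)⁻¹ * σ) := by
    intro b hb
    have hbσ : Composable (tw.sec b)⁻¹ σ :=
      tw.composable_inv_of_rng (by rw [tw.q_sec, hb1 b hb])
    have hba : ∀ a ∈ Fa, Composable (tw.sec b)⁻¹ (tw.sec a) := fun a ha =>
      tw.composable_inv_of_rng (by rw [tw.q_sec, tw.q_sec, hb1 b hb, ha1 a ha])
    rw [conv_eq_sum hg hh Fa (fun a => (tw.sec b)⁻¹ * tw.sec a)]
    · refine Finset.sum_congr rfl fun a ha => ?_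
      congr 2
      have haσ : Composable (tw.sec a)⁻¹ σ :=
        tw.composable_inv_of_rng (by rw [tw.q_sec, ha1 a ha])
      have h1 : Composable (tw.sec a)⁻¹ (tw.sec b) :=
        tw.composable_inv_of_rng (by rw [tw.q_sec, tw.q_sec, hb1 b hb, ha1 a ha])
      have h2 : Composable (tw.sec b) ((tw.sec b)⁻¹ * σ) := by
        rw [Composable, rng_mul hbσ, rng_inv]
      rw [mul_inv_rev' (hba a ha), inv_inv_eq, mul_assoc' h1 h2,
        mul_inv_mul (tw.rng_of_rng_q (by rw [tw.q_sec, hb1 b hb]))]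
    · intro a ha
      rw [← tw.q_hom.map_rng, ← tw.q_hom.map_rng, rng_mul (hba a ha), rng_mul hbσ]
    · intro a ha a' ha' e
      have e' : tw.q (tw.sec b)⁻¹ * tw.q (tw.sec a) =
          tw.q (tw.sec b)⁻¹ * tw.q (tw.sec a') := by
        rw [← tw.q_hom.map_mul (hba a ha), ← tw.q_hom.map_mul (hba a' ha')]
        exact e
      have := mul_left_cancel' (tw.q_hom.composable (hba a ha))
        (tw.q_hom.composable (hba a' ha')) e'
      rwa [tw.q_sec, tw.q_sec] at this
    · intro ρ hρ hgρ _
      have hbρ : Composable b (tw.q ρ) := by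
        rw [tw.q_hom.map_mul hbσ, rng_mul (tw.q_hom.composable hbσ), tw.q_hom.map_inv, tw.q_sec,
          rng_inv] at hρ
        exact hρ.symm
      by_cases hbf : b ∈ tw.suppG f
      · have hm := ha2 b (tw.q ρ) (hb1 b hb) hbf ⟨ρ, hgρ, rfl⟩ hbρ
        refine ⟨_, hm, ?_⟩
        rw [tw.q_hom.map_mul (hba _ hm), tw.q_hom.map_inv, tw.q_sec, tw.q_sec,
          inv_mul_cancel hbρ]
      · exact absurd ((mem_fibre cf).1 hb).2 hbf
  rw [L, conv_eq_sum_sec hf hgh Fb hb1 hb2]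
  simp only [Finset.sum_mul]
  rw [Finset.sum_comm]
  refine Finset.sum_congr rfl fun b hb => ?_
  rw [M b hb, Finset.mul_sum]
  refine Finset.sum_congr rfl fun a _ => ?_
  rw [mul_assoc]

end Ample

end Steinberg

end DiscreteTwist

namespace DiscreteTwist

section Indicator

theorem isLocallyConstant_indicator {X M : Type*} [TopologicalSpace X] [Zero M] {f : X → M}
    (lf : IsLocallyConstant f) {U : Set X} (hU : IsClopen U) :
    IsLocallyConstant (U.indicator f) := by
  rw [IsLocallyConstant.iff_eventually_eq]
  intro x
  by_cases hx : x ∈ U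
  · filter_upwards [hU.isOpen.mem_nhds hx, lf.eventually_eq x] with y hy h
    rw [indicator_of_mem hy, indicator_of_mem hx, h]
  · filter_upwards [hU.isClosed.isOpen_compl.mem_nhds hx] with y hy
    rw [indicator_of_notMem hy, indicator_of_notMem hx]

variable {R G S : Type*} [CommRing R] [TopologicalSpace Rˣ] [DiscreteTopology Rˣ]
  [ArrowGroupoid G] [TopologicalSpace G] [ArrowGroupoid S] [TopologicalSpace S]
  {tw : DiscreteTwist Rˣ G S} {f : S → R}

theorem contravariant_indicator (hf : tw.IsContravariant f) (U : Set G) :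
    tw.IsContravariant ((tw.q ⁻¹' U).indicator f) := by
  intro t σ
  by_cases hσ : σ ∈ tw.q ⁻¹' U
  · have hσ' : tw.act t σ ∈ tw.q ⁻¹' U := by
      change tw.q _ ∈ U
      rw [tw.q_act]
      exact hσ
    rw [indicator_of_mem hσ, indicator_of_mem hσ', hf]
  · have hσ' : tw.act t σ ∉ tw.q ⁻¹' U := by
      change tw.q _ ∉ U
      rw [tw.q_act]
      exact hσ
    rw [indicator_of_notMem hσ, indicator_of_notMem hσ', mul_zero]

theorem suppG_indicator (f : S → R) (U : Set G) :
    tw.suppG ((tw.q ⁻¹' U).indicator f) ⊆ tw.suppG f ∩ U := by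
  rintro _ ⟨σ, hσ, rfl⟩
  have h : σ ∈ tw.q ⁻¹' U := by
    by_contra hcon
    exact hσ (indicator_of_notMem hcon f)
  have hσ' : (tw.q ⁻¹' U).indicator f σ ≠ 0 := hσ
  rw [indicator_of_mem h] at hσ'
  exact ⟨⟨σ, hσ', rfl⟩, h⟩

theorem isCompact_suppG_of_subset (hf : tw.IsContravariant f) (lf : IsLocallyConstant f)
    {K : Set G} (hK : IsCompact K) (h : tw.suppG f ⊆ K) : IsCompact (tw.suppG f) :=
  hK.of_isClosed_subset (isClopen_suppG hf lf).isClosed h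

end Indicator

section Closure

variable {R G S : Type*} [CommRing R] [TopologicalSpace Rˣ] [DiscreteTopology Rˣ]
  [ArrowGroupoid G] [TopologicalSpace G] [IsTopological G] [T2Space G]
  [ArrowGroupoid S] [TopologicalSpace S] [IsTopological S]
  {tw : DiscreteTwist Rˣ G S} {f g : S → R}

theorem isLocallyConstant_conv_of_subset (hf : tw.IsContravariant f) (hg : tw.IsContravariant g)
    (lf : IsLocallyConstant f) (lg : IsLocallyConstant g) {B : Set G} (hB : IsOpenBisection B)
    (hBc : IsCompact B) {P : B → S} (hP : Continuous P) (hqP : ∀ b : B, tw.q (P b) = b)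
    (hfB : tw.suppG f ⊆ B) : IsLocallyConstant (tw.conv f g) := by
  have hcl : IsClosed (rng '' B) := (hBc.image continuous_rng).isClosed
  have hcont : Continuous fun σ : S => rng (tw.q σ) := continuous_rng.comp tw.continuous_q
  rw [IsLocallyConstant.iff_eventually_eq]
  intro σ₀
  by_cases hσ₀ : rng (tw.q σ₀) ∈ rng '' B
  · set U : Set S := {σ | rng (tw.q σ) ∈ rng '' B} with hU
    have hUo : IsOpen U := hB.isOpen_rng.preimage hcont
    have hmem : ∀ u : U, rng (tw.q u.1) ∈ Set.range (B.domRestrict rng) := by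
      intro u
      rw [range_domRestrict]
      exact u.2
    set e := hB.isEmbedding_rng.toHomeomorph with he
    set β : U → B := fun u => e.symm ⟨rng (tw.q u.1), hmem u⟩ with hβ
    have hβc : Continuous β :=
      e.symm.continuous.comp ((hcont.comp continuous_subtype_val).subtype_mk _)
    have hβr : ∀ u, rng (β u).1 = rng (tw.q u.1) := by
      intro u
      have := congrArg Subtype.val (e.apply_symm_apply ⟨rng (tw.q u.1), hmem u⟩)
      exact this
    have hr : ∀ u : U, rng (tw.q (P (β u))) = rng (tw.q u.1) := by
      intro u
      rw [hqP, hβr]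
    have hc : Continuous fun u : U => (P (β u))⁻¹ * u.1 :=
      continuous_mul_of (continuous_inv'.comp (hP.comp hβc)) continuous_subtype_val
        fun u => tw.composable_inv_of_rng (hr u)
    have hlc : IsLocallyConstant fun u : U => f (P (β u)) * g ((P (β u))⁻¹ * u.1) :=
      (lf.comp_continuous (hP.comp hβc)).mul (lg.comp_continuous hc)
    have hval : ∀ u : U, tw.conv f g u.1 = f (P (β u)) * g ((P (β u))⁻¹ * u.1) := by
      intro u
      rw [conv_eq_sum hf hg ({()} : Finset Unit) (fun _ => P (β u)) (fun _ _ => hr u)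
        (fun _ _ _ _ _ => rfl)]
      · simp
      · intro ρ hρ hne _
        refine ⟨(), by simp, ?_⟩
        rw [hqP]
        refine hB.injOn_rng (β u).2 (hfB ⟨ρ, hne, rfl⟩) ?_
        rw [hβr, hρ]
    have h1 := hlc.eventually_eq ⟨σ₀, hσ₀⟩
    rw [nhds_subtype_eq_comap, Filter.eventually_comap] at h1
    filter_upwards [h1, hUo.mem_nhds hσ₀] with σ h hσ
    have h2 := hval ⟨σ, hσ⟩
    have h3 := hval ⟨σ₀, hσ₀⟩
    exact h2.trans ((h ⟨σ, hσ⟩ rfl).trans h3.symm)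
  · have hz : ∀ σ : S, rng (tw.q σ) ∉ rng '' B → tw.conv f g σ = 0 := by
      intro σ hσ
      by_contra hne
      obtain ⟨τ, hr, hfτ, -⟩ := exists_of_conv_ne_zero hne
      exact hσ ⟨tw.q τ, hfB ⟨τ, hfτ, rfl⟩, hr⟩
    filter_upwards [(hcl.isOpen_compl.preimage hcont).mem_nhds hσ₀] with σ hσ
    rw [hz σ hσ, hz σ₀ hσ₀]

variable [IsAmple G]

theorem isLocallyConstant_conv_of_cover (hg : tw.IsContravariant g) (lg : IsLocallyConstant g)
    {ι : Type*} (s : Finset ι) (B : ι → Set G) (hB : ∀ a, IsOpenBisection (B a))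
    (hBc : ∀ a, IsCompact (B a)) (P : ∀ a, B a → S) (hP : ∀ a, Continuous (P a))
    (hqP : ∀ a, ∀ b : B a, tw.q (P a b) = b) :
    ∀ f : S → R, tw.IsContravariant f → IsLocallyConstant f → IsCompact (tw.suppG f) →
      tw.suppG f ⊆ ⋃ a ∈ s, B a → IsLocallyConstant (tw.conv f g) := by
  classical
  induction s using Finset.induction_on with
  | empty =>
    intro f _ _ _ hs
    have hz : tw.conv f g = Function.const S 0 := by
      funext σ
      by_contra hne
      obtain ⟨τ, -, hfτ, -⟩ := exists_of_conv_ne_zero hne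
      simpa using hs ⟨τ, hfτ, rfl⟩
    rw [hz]
    exact IsLocallyConstant.const 0
  | insert a s _ ih =>
    intro f hf lf cf hs
    have hcl₀ : IsClopen (B a) := ⟨(hBc a).isClosed, (hB a).isOpen⟩
    have hcl : IsClopen (tw.q ⁻¹' B a) := hcl₀.preimage tw.continuous_q
    have hcl' : IsClopen (tw.q ⁻¹' (B a)ᶜ) := hcl.compl
    set f₁ := (tw.q ⁻¹' B a).indicator f with hf₁
    set f₂ := (tw.q ⁻¹' (B a)ᶜ).indicator f with hf₂
    have e : f = f₁ + f₂ := (indicator_self_add_compl (tw.q ⁻¹' B a) f).symm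
    have l₁ : IsLocallyConstant f₁ := isLocallyConstant_indicator lf hcl
    have l₂ : IsLocallyConstant f₂ := isLocallyConstant_indicator lf hcl'
    have k₁ : tw.IsContravariant f₁ := contravariant_indicator hf _
    have k₂ : tw.IsContravariant f₂ := contravariant_indicator hf _
    have s₁ := suppG_indicator (tw := tw) f (B a)
    have s₂ := suppG_indicator (tw := tw) f (B a)ᶜ
    have c₁ := isCompact_suppG_of_subset k₁ l₁ cf (s₁.trans inter_subset_left)
    have c₂ := isCompact_suppG_of_subset k₂ l₂ cf (s₂.trans inter_subset_left)
    rw [e, conv_add_left k₁ k₂ hg c₁ c₂]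
    refine (isLocallyConstant_conv_of_subset k₁ hg l₁ lg (hB a) (hBc a) (hP a) (hqP a)
      (s₁.trans inter_subset_right)).add (ih f₂ k₂ l₂ c₂ ?_)
    intro x hx
    have hx' := s₂ hx
    have := hs hx'.1
    rw [Finset.set_biUnion_insert] at this
    exact this.resolve_left hx'.2

theorem isLocallyConstant_conv (hf : tw.IsContravariant f) (hg : tw.IsContravariant g)
    (lf : IsLocallyConstant f) (lg : IsLocallyConstant g) (cf : IsCompact (tw.suppG f)) :
    IsLocallyConstant (tw.conv f g) := by
  have key : ∀ a : G, ∃ (B : Set G) (P : B → S), a ∈ B ∧ IsOpenBisection B ∧ IsCompact B ∧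
      Continuous P ∧ ∀ b : B, tw.q (P b) = b := by
    intro a
    obtain ⟨B, P, haB, hB, hP, hqP, -, -⟩ := tw.locally_trivial a
    obtain ⟨C, ⟨hCc, hC⟩, haC, hCB⟩ :=
      (IsAmple.isTopologicalBasis (G := G)).exists_subset_of_mem_open haB hB.isOpen
    exact ⟨C, fun c => P ⟨c.1, hCB c.2⟩, haC, hC, hCc,
      hP.comp (IsEmbedding.inclusion hCB).continuous, fun c => hqP _⟩
  choose B P haB hB hBc hP hqP using key
  obtain ⟨s, hs⟩ := cf.elim_finite_subcover B (fun a => (hB a).isOpen)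
    fun a _ => mem_iUnion.2 ⟨a, haB a⟩
  exact isLocallyConstant_conv_of_cover hg lg s B hB hBc P hP hqP f hf lf cf hs

theorem isCompact_suppG_conv (hf : tw.IsContravariant f) (hg : tw.IsContravariant g)
    (lf : IsLocallyConstant f) (lg : IsLocallyConstant g) (cf : IsCompact (tw.suppG f))
    (cg : IsCompact (tw.suppG g)) : IsCompact (tw.suppG (tw.conv f g)) := by
  have hcl : IsClosed {p : G × G | Composable p.1 p.2} :=
    isClosed_eq (continuous_src.comp continuous_fst) (continuous_rng.comp continuous_snd)
  have hK : IsCompact ((tw.suppG f ×ˢ tw.suppG g) ∩ {p : G × G | Composable p.1 p.2}) :=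
    (cf.prod cg).inter_right hcl
  have hI := hK.image_of_continuousOn
    ((IsTopological.continuousOn_mul (G := G)).mono inter_subset_right)
  refine isCompact_suppG_of_subset (conv_contravariant hf hg cf)
    (isLocallyConstant_conv hf hg lf lg cf) hI ?_
  rintro _ ⟨σ, hσ, rfl⟩
  obtain ⟨a, ha, b, hb, hab, e⟩ := exists_mul_of_conv_ne_zero hσ
  exact ⟨(a, b), ⟨⟨ha, hb⟩, hab⟩, e.symm⟩

end Closure

section Algebra

variable (R : Type*) {G S : Type*} [CommRing R] [TopologicalSpace Rˣ] [DiscreteTopology Rˣ]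
  [ArrowGroupoid G] [TopologicalSpace G] [ArrowGroupoid S] [TopologicalSpace S]
  (tw : DiscreteTwist Rˣ G S)

/-- The module underlying the twisted Steinberg algebra: locally constant contravariant functions
on the total groupoid whose support has compact image in `G`. -/
def steinbergSubmodule : Submodule R (S → R) where
  carrier := {f | IsLocallyConstant f ∧ tw.IsContravariant f ∧ IsCompact (tw.suppG f)}
  zero_mem' := by
    refine ⟨IsLocallyConstant.const 0, fun t σ => by simp, ?_⟩
    have : tw.suppG (0 : S → R) = ∅ := by simp [suppG]
    rw [this]
    exact isCompact_empty
  add_mem' := by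
    rintro f g ⟨lf, hf, cf⟩ ⟨lg, hg, cg⟩
    exact ⟨lf.add lg, hf.add hg, isCompact_suppG_of_subset (hf.add hg) (lf.add lg)
      (cf.union cg) (suppG_add_subset f g)⟩
  smul_mem' := by
    rintro r f ⟨lf, hf, cf⟩
    have l : IsLocallyConstant (r • f) := lf.comp (fun x => r • x)
    refine ⟨l, hf.smul r, isCompact_suppG_of_subset (hf.smul r) l cf ?_⟩
    rintro _ ⟨σ, hσ, rfl⟩
    refine ⟨σ, fun h0 => hσ ?_, rfl⟩
    simp [h0]

/-- The twisted Steinberg algebra `A_R(G; S)` of a discrete `R`-twist. -/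
def Steinberg : Type _ := tw.steinbergSubmodule R

namespace Steinberg

noncomputable instance : AddCommGroup (tw.Steinberg R) :=
  inferInstanceAs (AddCommGroup (tw.steinbergSubmodule R))

noncomputable instance : Module R (tw.Steinberg R) :=
  inferInstanceAs (Module R (tw.steinbergSubmodule R))

variable {R tw}

/-- The function on the total groupoid given by an element of the algebra. -/
def toFun (f : tw.Steinberg R) : S → R := f.1

theorem toFun_injective : Function.Injective (toFun : tw.Steinberg R → S → R) :=
  Subtype.val_injective

theorem toFun_add (f g : tw.Steinberg R) : (f + g).toFun = f.toFun + g.toFun := rfl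

theorem toFun_zero : (0 : tw.Steinberg R).toFun = 0 := rfl

theorem toFun_smul (r : R) (f : tw.Steinberg R) : (r • f).toFun = r • f.toFun := rfl

theorem locallyConstant (f : tw.Steinberg R) : IsLocallyConstant f.toFun := f.2.1

theorem contravariant (f : tw.Steinberg R) : tw.IsContravariant f.toFun := f.2.2.1

theorem isCompact_suppG (f : tw.Steinberg R) : IsCompact (tw.suppG f.toFun) := f.2.2.2

variable [IsTopological G] [T2Space G] [IsAmple G] [IsTopological S]

noncomputable instance : Mul (tw.Steinberg R) :=
  ⟨fun f g => ⟨tw.conv f.toFun g.toFun,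
    isLocallyConstant_conv f.contravariant g.contravariant f.locallyConstant g.locallyConstant
      f.isCompact_suppG,
    conv_contravariant f.contravariant g.contravariant f.isCompact_suppG,
    isCompact_suppG_conv f.contravariant g.contravariant f.locallyConstant g.locallyConstant
      f.isCompact_suppG g.isCompact_suppG⟩⟩

theorem toFun_mul (f g : tw.Steinberg R) : (f * g).toFun = tw.conv f.toFun g.toFun := rfl

theorem add_mul' (f g h : tw.Steinberg R) : (f + g) * h = f * h + g * h :=
  toFun_injective (conv_add_left f.contravariant g.contravariant h.contravariant
    f.isCompact_suppG g.isCompact_suppG)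

theorem mul_add' (f g h : tw.Steinberg R) : f * (g + h) = f * g + f * h :=
  toFun_injective (conv_add_right f.contravariant g.contravariant h.contravariant
    f.isCompact_suppG)

noncomputable instance : NonUnitalRing (tw.Steinberg R) where
  left_distrib := mul_add'
  right_distrib := add_mul'
  zero_mul f := by
    have h := add_mul' 0 0 f
    rw [add_zero] at h
    exact left_eq_add.1 h
  mul_zero f := by
    have h := mul_add' f 0 0
    rw [add_zero] at h
    exact left_eq_add.1 h
  mul_assoc f g h := toFun_injective (conv_assoc f.contravariant g.contravariant
    h.contravariant f.isCompact_suppG g.isCompact_suppG)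

instance : IsScalarTower R (tw.Steinberg R) (tw.Steinberg R) :=
  ⟨fun r f g => toFun_injective
    (conv_smul_left f.contravariant g.contravariant f.isCompact_suppG r)⟩

instance : SMulCommClass R (tw.Steinberg R) (tw.Steinberg R) :=
  ⟨fun r f g => toFun_injective
    (conv_smul_right f.contravariant g.contravariant f.isCompact_suppG r).symm⟩

end Steinberg

end Algebra

section Subalgebras

variable (R : Type*) {G S : Type*} [CommRing R] [TopologicalSpace Rˣ] [DiscreteTopology Rˣ]
  [ArrowGroupoid G] [TopologicalSpace G] [IsTopological G] [T2Space G] [IsAmple G]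
  [ArrowGroupoid S] [TopologicalSpace S] [IsTopological S]
  (tw : DiscreteTwist Rˣ G S)

namespace Steinberg

/-- The functions in the twisted Steinberg algebra whose support has image contained in `X`. -/
def supportedIn (X : Set G) : Submodule R (tw.Steinberg R) where
  carrier := {f | tw.suppG f.toFun ⊆ X}
  zero_mem' := by
    rintro _ ⟨σ, hσ, rfl⟩
    exact absurd rfl hσ
  add_mem' {f g} hf hg := (suppG_add_subset f.toFun g.toFun).trans (union_subset hf hg)
  smul_mem' r f hf := by
    rintro _ ⟨σ, hσ, rfl⟩
    refine hf ⟨σ, fun h0 => hσ ?_, rfl⟩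
    rw [toFun_smul, Pi.smul_apply, h0, smul_zero]

/-- The diagonal subalgebra `A_R(G⁽⁰⁾; q⁻¹(G⁽⁰⁾))`, embedded in the twisted Steinberg algebra by
extending functions by zero: the functions that vanish outside `q⁻¹(G⁽⁰⁾)`. -/
def diagonal : NonUnitalSubalgebra R (tw.Steinberg R) where
  toSubmodule := supportedIn R tw (units G)
  mul_mem' {f g} hf hg := by
    rintro _ ⟨σ, hσ, rfl⟩
    obtain ⟨a, ha, b, hb, hab, e⟩ := exists_mul_of_conv_ne_zero hσ
    rw [e]
    exact mul_mem_units hab (hf ha) (hg hb)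

end Steinberg

end Subalgebras

end DiscreteTwist

/-! ### Algebraic pairs -/

namespace AlgebraicPair

section Ungraded

variable {R A : Type*} [CommRing R] [NonUnitalRing A] [Module R A] [IsScalarTower R A A]
  [SMulCommClass R A A] (C : NonUnitalSubalgebra R A)

/-- The idempotents of `C`. -/
def idempotents : Set A := {e | e ∈ C ∧ e * e = e}

/-- `m` witnesses that `n` is a normaliser of `C`. -/
structure IsNormaliserInverse (n m : A) : Prop where
  mul_left : m * n * m = m
  mul_right : n * m * n = n
  conj_mem : ∀ c ∈ C, m * c * n ∈ C
  conj_mem' : ∀ c ∈ C, n * c * m ∈ C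

/-- The normalisers of `C` in `A`. -/
def normalisers : Set A := {n | ∃ m, IsNormaliserInverse C n m}

/-- The free normalisers of `C` in `A`: normalisers `n` such that `n ∈ C` or
`(n† n)(n n†) = 0`. -/
def freeNormalisers : Set A :=
  {n | n ∈ normalisers C ∧ (n ∈ C ∨ ∃ m, IsNormaliserInverse C n m ∧ (m * n) * (n * m) = 0)}

/-- Conditional expectations from `A` to `C`. -/
structure IsConditionalExpectation (P : A →ₗ[R] C) : Prop where
  apply_coe : ∀ c : C, P c = c
  bimodule : ∀ (a : A) (c c' : C), P (c * a * c') = c * P a * c'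

/-- Faithful conditional expectations. -/
structure IsFaithfulExpectation (P : A →ₗ[R] C) : Prop
    extends IsConditionalExpectation C P where
  faithful : ∀ a : A, a ≠ 0 → ∃ n ∈ normalisers C, P (n * a) ≠ 0

/-- `P` is implemented by idempotents. -/
def IsImplementedByIdempotents (P : A →ₗ[R] C) : Prop :=
  ∀ n ∈ normalisers C, ∃ e ∈ idempotents C, (P n : A) = n * e ∧ n * e = e * n

/-- The conditions common to all three kinds of algebraic pairs. -/
structure IsBasicPair : Prop where
  comm : ∀ c ∈ C, ∀ d ∈ C, c * d = d * c
  without_torsion : ∀ e ∈ idempotents C, e ≠ 0 → ∀ t : R, t • e = 0 → t = 0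
  local_units : ∀ F : Finset A, ∃ e ∈ idempotents C, ∀ a ∈ F, e * a = a ∧ a * e = a
  span_idempotents : Submodule.span R (idempotents C) = C.toSubmodule
  span_normalisers : Submodule.span R (normalisers C) = ⊤
  exists_expectation : ∃ P : A →ₗ[R] C, IsFaithfulExpectation C P

/-- Algebraic diagonal pairs. -/
structure IsADP : Prop extends IsBasicPair C where
  span_free : Submodule.span R (freeNormalisers C) = ⊤

/-- Algebraic Cartan pairs: `C` is a maximal commutative subalgebra. -/
structure IsACP : Prop extends IsBasicPair C where
  maximal : ∀ D : NonUnitalSubalgebra R A, (∀ c ∈ D, ∀ d ∈ D, c * d = d * c) → C ≤ D → D = C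

/-- Algebraic quasi-Cartan pairs. -/
structure IsAQP : Prop extends IsBasicPair C where
  implemented : ∃ P : A →ₗ[R] C, IsFaithfulExpectation C P ∧ IsImplementedByIdempotents C P

end Ungraded

section Graded

variable {R A Γ : Type*} [CommRing R] [NonUnitalRing A] [Module R A] [IsScalarTower R A A]
  [SMulCommClass R A A] [Group Γ] (𝒜 : Γ → Submodule R A) (C : NonUnitalSubalgebra R A)

open Classical in
/-- The family `𝒜` of submodules is a `Γ`-grading of the algebra `A`. -/
structure IsGrading : Prop where
  isInternal : DirectSum.IsInternal 𝒜
  mul_mem : ∀ {γ δ : Γ} {a b : A}, a ∈ 𝒜 γ → b ∈ 𝒜 δ → a * b ∈ 𝒜 (γ * δ)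

variable {𝒜} in
/-- The homogeneous component of degree the identity, as a subalgebra. -/
def IsGrading.oneComponent (h : IsGrading 𝒜) : NonUnitalSubalgebra R A where
  toSubmodule := 𝒜 1
  mul_mem' {a b} ha hb := by
    have := h.mul_mem ha hb
    rwa [one_mul] at this

variable {𝒜} in
/-- `C` as a subalgebra of the homogeneous component of degree the identity. -/
def IsGrading.inOne (h : IsGrading 𝒜) : NonUnitalSubalgebra R h.oneComponent :=
  C.comap (NonUnitalSubalgebraClass.subtype h.oneComponent)

/-- The homogeneous normalisers of `C` in the graded algebra `A`. -/
def homogeneousNormalisers : Set A := {n | n ∈ normalisers C ∧ ∃ γ, n ∈ 𝒜 γ}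

/-- The conditions common to all three kinds of graded algebraic pairs: `𝒜` is a grading of the
algebra, `C` lies in the homogeneous component of degree the identity, and the homogeneous
normalisers of `C` span the algebra. -/
structure IsGradedBasicPair : Prop where
  grading : IsGrading 𝒜
  le_one : C.toSubmodule ≤ 𝒜 1
  span_homogeneous : Submodule.span R (homogeneousNormalisers 𝒜 C) = ⊤

/-- Graded algebraic diagonal pairs. -/
structure IsGrADP : Prop extends IsGradedBasicPair 𝒜 C where
  isADP : IsADP (grading.inOne C)

/-- Graded algebraic Cartan pairs. -/
structure IsGrACP : Prop extends IsGradedBasicPair 𝒜 C where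
  isACP : IsACP (grading.inOne C)

/-- Graded algebraic quasi-Cartan pairs. -/
structure IsGrAQP : Prop extends IsGradedBasicPair 𝒜 C where
  isAQP : IsAQP (grading.inOne C)

end Graded

end AlgebraicPair

/-! ### The local bisection hypothesis and graded twists -/

/-- The local bisection hypothesis: every normaliser of the diagonal subalgebra in the twisted
Steinberg algebra is supported on an open bisection. -/
def DiscreteTwist.LocalBisectionHypothesis (R : Type*) {G S : Type*} [CommRing R]
    [TopologicalSpace Rˣ] [DiscreteTopology Rˣ]
    [ArrowGroupoid G] [TopologicalSpace G] [IsTopological G] [T2Space G] [IsAmple G]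
    [ArrowGroupoid S] [TopologicalSpace S] [IsTopological S]
    (tw : DiscreteTwist Rˣ G S) : Prop :=
  ∀ n ∈ AlgebraicPair.normalisers (DiscreteTwist.Steinberg.diagonal R tw),
    IsOpenBisection (tw.suppG n.toFun)

/-- A `Γ`-graded discrete twist: a discrete twist by `T` together with continuous homomorphisms
`cS` and `cG` of the groupoids to the discrete group `Γ` such that `cS = cG ∘ q`. -/
structure GradedDiscreteTwist (Γ T G S : Type*) [Group Γ] [TopologicalSpace Γ]
    [DiscreteTopology Γ] [CommGroup T] [TopologicalSpace T] [DiscreteTopology T]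
    [ArrowGroupoid G] [TopologicalSpace G] [ArrowGroupoid S] [TopologicalSpace S]
    extends DiscreteTwist T G S where
  cG : G → Γ
  cS : S → Γ
  continuous_cG : Continuous cG
  continuous_cS : Continuous cS
  cG_mul : ∀ a b : G, Composable a b → cG (a * b) = cG a * cG b
  cS_mul : ∀ a b : S, Composable a b → cS (a * b) = cS a * cS b
  cS_eq : ∀ σ : S, cS σ = cG (q σ)

namespace GradedDiscreteTwist

section Identity

variable {Γ T G S : Type*} [Group Γ] [TopologicalSpace Γ]
  [DiscreteTopology Γ] [CommGroup T] [TopologicalSpace T] [DiscreteTopology T]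
  [ArrowGroupoid G] [TopologicalSpace G] [ArrowGroupoid S] [TopologicalSpace S]
  (tw : GradedDiscreteTwist Γ T G S)

theorem cG_inv (a : G) : tw.cG a⁻¹ = (tw.cG a)⁻¹ := by
  have h1 : a⁻¹ * (a * a⁻¹) = a⁻¹ := inv_mul_cancel (composable_inv_right a)
  have hc : Composable a⁻¹ (a * a⁻¹) := by
    rw [Composable, src_inv]
    exact (rng_rng a).symm
  have h2 := congrArg tw.cG h1
  rw [tw.cG_mul _ _ hc, tw.cG_mul _ _ (composable_inv_right a)] at h2
  exact (inv_eq_of_mul_eq_one_right (mul_eq_left.1 h2)).symm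

/-- The open subgroupoid of `G` of arrows of degree the identity. -/
def identityPart : OpenSubgroupoid G where
  carrier := tw.cG ⁻¹' {1}
  isOpen := (isOpen_discrete _).preimage tw.continuous_cG
  mul_mem {a b} ha hb h := by
    have ha' : tw.cG a = 1 := ha
    have hb' : tw.cG b = 1 := hb
    change tw.cG (a * b) = 1
    rw [tw.cG_mul a b h, ha', hb', one_mul]
  inv_mem {a} ha := by
    have ha' : tw.cG a = 1 := ha
    change tw.cG a⁻¹ = 1
    rw [tw.cG_inv, ha', inv_one]

/-- The discrete twist over the arrows of degree the identity. -/
noncomputable def identityTwist :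
    DiscreteTwist T tw.identityPart (tw.toDiscreteTwist.preimage tw.identityPart) :=
  tw.toDiscreteTwist.restrict tw.identityPart

end Identity

/-- The homogeneous components of the graded twisted Steinberg algebra. -/
def component (R : Type*) {Γ G S : Type*} [CommRing R]
    [TopologicalSpace Rˣ] [DiscreteTopology Rˣ]
    [ArrowGroupoid G] [TopologicalSpace G] [IsTopological G] [T2Space G] [IsAmple G]
    [ArrowGroupoid S] [TopologicalSpace S] [IsTopological S]
    [Group Γ] [TopologicalSpace Γ] [DiscreteTopology Γ]
    (tw : GradedDiscreteTwist Γ Rˣ G S) (γ : Γ) : Submodule R (tw.toDiscreteTwist.Steinberg R) :=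
  DiscreteTwist.Steinberg.supportedIn R tw.toDiscreteTwist (tw.cG ⁻¹' {γ})

end GradedDiscreteTwist

open DiscreteTwist AlgebraicPair GradedDiscreteTwist

/-!
The three statements concern the pair `(A_ε, C)`, where `A_ε` is the component of degree the
identity.  Extension by zero is an isomorphism from the twisted Steinberg algebra of `Σ_ε → G_ε`
onto `A_ε` that matches the diagonals (`GradedDiscreteTwist.pairEquiv`), and the properties of
being an ADP, ACP or AQP are invariant under such isomorphisms (`AlgebraicPair.PairEquiv`).  So
it suffices to treat an arbitrary ungraded discrete twist, and to show that `A` is graded and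
spanned by homogeneous normalisers.

The working tool is the supply of *monomials*: unit-valued elements supported over a compact open
bisection.  Local trivialisations provide one near any arrow (`Steinberg.exists_isMonomial`), every
element is locally a scalar multiple of one, and compactness makes the monomials supported in
arbitrarily small open sets span the algebra (`Steinberg.eq_top_of_isMonomial_mem`).  A monomial
is a normaliser, with inverse `σ ↦ u(σ⁻¹)⁻¹`.  Hence the normalisers span, the homogeneous ones
span because the sets `G_γ` are open, and in the principal case the free ones span, because a
non-unit arrow has distinct range and source, which can be separated.  Restriction to the unit
space is a faithful conditional expectation, since an arrow in the support of an element can be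
translated to a unit by a monomial.  An element commuting with the diagonal is supported on the
interior of the isotropy, which gives maximality in the effective case.

For the third statement, an expectation implemented by idempotents agrees with restriction to the
unit space on monomials supported on units or off the units, hence everywhere
(`Steinberg.eq_expectation_of_isImplementedByIdempotents`).  As `R` is indecomposable, idempotents
of the diagonal take the values zero and one on units, so a normaliser that is nonzero at a unit
vanishes at all other arrows starting or ending there (`Steinberg.mem_units_of_implemented`);
translating by monomials shows that the support of any normaliser is a bisection.  Conversely, if
the support of `n` is a bisection, the indicator of its units implements the expectation at `n`.
-/

/-! ### Étale properties of ample groupoids -/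

namespace ArrowGroupoid

variable {G : Type*} [ArrowGroupoid G]

theorem mem_units_iff_src_eq {a : G} : a ∈ units G ↔ src a = a :=
  ⟨src_of_mem_units, fun h => h ▸ src_mem_units a⟩

theorem inv_mul_mem_units_iff {a b : G} (h : rng a = rng b) :
    a⁻¹ * b ∈ units G ↔ a = b := by
  constructor
  · intro hu
    have hc : Composable a⁻¹ b := by rw [Composable, src_inv, h]
    have h1 : a⁻¹ * b = src a := by
      rw [← rng_of_mem_units hu, rng_mul hc, rng_inv]
    rw [← mul_inv_mul h, h1, mul_src]
  · rintro rfl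
    exact src_mem_units a

variable [TopologicalSpace G]

theorem isOpenMap_rng [IsAmple G] : IsOpenMap (rng : G → G) := by
  intro U hU
  rw [isOpen_iff_mem_nhds]
  rintro _ ⟨a, ha, rfl⟩
  obtain ⟨B, ⟨-, hB⟩, haB, hBU⟩ :=
    (IsAmple.isTopologicalBasis (G := G)).exists_subset_of_mem_open ha hU
  exact Filter.mem_of_superset (hB.isOpen_rng.mem_nhds (mem_image_of_mem _ haB))
    (image_mono hBU)

theorem isOpenMap_src [IsAmple G] : IsOpenMap (src : G → G) := by
  intro U hU
  rw [isOpen_iff_mem_nhds]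
  rintro _ ⟨a, ha, rfl⟩
  obtain ⟨B, ⟨-, hB⟩, haB, hBU⟩ :=
    (IsAmple.isTopologicalBasis (G := G)).exists_subset_of_mem_open ha hU
  exact Filter.mem_of_superset (hB.isOpen_src.mem_nhds (mem_image_of_mem _ haB))
    (image_mono hBU)

theorem isClopen_units [IsTopological G] [T2Space G] [IsAmple G] : IsClopen (units G) := by
  refine ⟨?_, ?_⟩
  · have h : units G = {a | src a = a} := Set.ext fun a => mem_units_iff_src_eq
    rw [h]
    exact isClosed_eq continuous_src continuous_id
  · exact isOpenMap_src.isOpen_range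

theorem isOpenBisection_of_injOn [IsTopological G] [IsAmple G] {B : Set G} (hB : IsOpen B)
    (hr : InjOn rng B) (hs : InjOn src B) : IsOpenBisection B where
  isOpen := hB
  isOpen_rng := isOpenMap_rng B hB
  isOpen_src := isOpenMap_src B hB
  isEmbedding_rng := (IsOpenEmbedding.of_continuous_injective_isOpenMap
    (continuous_rng.comp continuous_subtype_val) (injOn_iff_injective.1 hr)
    (isOpenMap_rng.comp hB.isOpenMap_subtype_val)).isEmbedding
  isEmbedding_src := (IsOpenEmbedding.of_continuous_injective_isOpenMap
    (continuous_src.comp continuous_subtype_val) (injOn_iff_injective.1 hs)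
    (isOpenMap_src.comp hB.isOpenMap_subtype_val)).isEmbedding

theorem IsOpenBisection.injOn_src {B : Set G} (hB : IsOpenBisection B) : InjOn src B :=
  injOn_iff_injective.2 hB.isEmbedding_src.injective

end ArrowGroupoid

/-! ### The action of the structure group of a twist -/

namespace DiscreteTwist

section Action

variable {T G S : Type*} [CommGroup T] [TopologicalSpace T] [DiscreteTopology T]
  [ArrowGroupoid G] [TopologicalSpace G] [ArrowGroupoid S] [TopologicalSpace S]
  (tw : DiscreteTwist T G S)

theorem act_injective {s t : T} {σ : S} (h : tw.act s σ = tw.act t σ) : s = t := by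
  have h1 : ∀ r : T, tw.act r σ * σ⁻¹ = tw.i (⟨rng (tw.q σ), rng_mem_units (tw.q σ)⟩, r) :=
    fun r => mul_inv_cancel (tw.act_composable r σ)
  have h2 := tw.i_injective ((h1 s).symm.trans ((congrArg (· * σ⁻¹) h).trans (h1 t)))
  exact congrArg Prod.snd h2

theorem mem_units_of_q {σ : S} (h : σ ∈ units S) : tw.q σ ∈ units G := by
  rw [← tw.q_image_units]
  exact mem_image_of_mem _ h

theorem q_inv_mul_mem_units_iff {σ τ : S} (h : rng (tw.q τ) = rng (tw.q σ)) :
    tw.q (τ⁻¹ * σ) ∈ units G ↔ tw.q τ = tw.q σ := by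
  have hc : Composable τ⁻¹ σ := by
    rw [Composable, src_inv]
    refine tw.units_ext (rng_mem_units _) (rng_mem_units _) ?_
    rw [tw.q_hom.map_rng, tw.q_hom.map_rng, h]
  rw [tw.q_hom.map_mul hc, tw.q_hom.map_inv, inv_mul_mem_units_iff h]

theorem src_eq_rng_of_q_mem {σ : S} (h : tw.q σ ∈ units G) : src σ = rng σ := by
  refine tw.units_ext (src_mem_units _) (rng_mem_units _) ?_
  rw [tw.q_hom.map_src, tw.q_hom.map_rng, src_of_mem_units h, rng_of_mem_units h]

theorem q_rng_of_q_mem {σ : S} (h : tw.q σ ∈ units G) : tw.q (rng σ) = tw.q σ := by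
  rw [tw.q_hom.map_rng, rng_of_mem_units h]

end Action

/-! ### Restriction to clopen sets, and monomials -/

namespace Steinberg

variable {R G S : Type*} [CommRing R] [TopologicalSpace Rˣ] [DiscreteTopology Rˣ]
  [ArrowGroupoid G] [TopologicalSpace G] [ArrowGroupoid S] [TopologicalSpace S]
  {tw : DiscreteTwist Rˣ G S}

@[ext] theorem ext {f g : tw.Steinberg R} (h : ∀ σ, f.toFun σ = g.toFun σ) : f = g :=
  toFun_injective (funext h)

theorem toFun_act (f : tw.Steinberg R) (t : Rˣ) (σ : S) :
    f.toFun (tw.act t σ) = (↑t⁻¹ : R) * f.toFun σ :=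
  f.contravariant t σ

theorem q_mem_suppG_iff (f : tw.Steinberg R) (σ : S) :
    tw.q σ ∈ tw.suppG f.toFun ↔ f.toFun σ ≠ 0 :=
  f.contravariant.mem_suppG_iff σ

theorem isClopen_suppG (f : tw.Steinberg R) : IsClopen (tw.suppG f.toFun) :=
  DiscreteTwist.isClopen_suppG f.contravariant f.locallyConstant

/-- The restriction of `f` to the part of the total groupoid over a clopen set, extended by
zero. -/
noncomputable def restr (f : tw.Steinberg R) {X : Set G} (hX : IsClopen X) : tw.Steinberg R :=
  ⟨(tw.q ⁻¹' X).indicator f.toFun,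
    isLocallyConstant_indicator f.locallyConstant (hX.preimage tw.continuous_q),
    contravariant_indicator f.contravariant X,
    isCompact_suppG_of_subset (contravariant_indicator f.contravariant X)
      (isLocallyConstant_indicator f.locallyConstant (hX.preimage tw.continuous_q))
      f.isCompact_suppG ((suppG_indicator f.toFun X).trans inter_subset_left)⟩

theorem restr_apply_of_mem (f : tw.Steinberg R) {X : Set G} (hX : IsClopen X) {σ : S}
    (h : tw.q σ ∈ X) : (f.restr hX).toFun σ = f.toFun σ :=
  indicator_of_mem (s := tw.q ⁻¹' X) h _

theorem restr_apply_of_notMem (f : tw.Steinberg R) {X : Set G} (hX : IsClopen X) {σ : S}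
    (h : tw.q σ ∉ X) : (f.restr hX).toFun σ = 0 :=
  indicator_of_notMem (s := tw.q ⁻¹' X) h _

theorem suppG_restr (f : tw.Steinberg R) {X : Set G} (hX : IsClopen X) :
    tw.suppG (f.restr hX).toFun = tw.suppG f.toFun ∩ X := by
  refine (suppG_indicator f.toFun X).antisymm ?_
  rintro _ ⟨⟨σ, hσ, rfl⟩, hX'⟩
  refine ⟨σ, ?_, rfl⟩
  change (f.restr hX).toFun σ ≠ 0
  rwa [restr_apply_of_mem f hX hX']

theorem restr_eq_self (f : tw.Steinberg R) {X : Set G} (hX : IsClopen X)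
    (h : tw.suppG f.toFun ⊆ X) : f.restr hX = f := by
  ext σ
  by_cases hσ : tw.q σ ∈ X
  · exact restr_apply_of_mem f hX hσ
  · rw [restr_apply_of_notMem f hX hσ]
    by_contra hne
    exact hσ (h ⟨σ, Ne.symm hne, rfl⟩)

theorem restr_eq_add (f : tw.Steinberg R) {X Y : Set G} (hX : IsClopen X) (hY : IsClopen Y) :
    f.restr hY = f.restr (hY.inter hX) + f.restr (hY.diff hX) := by
  ext σ
  rw [toFun_add, Pi.add_apply]
  by_cases h1 : tw.q σ ∈ Y <;> by_cases h2 : tw.q σ ∈ X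
  · rw [restr_apply_of_mem f hY h1, restr_apply_of_mem f (hY.inter hX) ⟨h1, h2⟩,
      restr_apply_of_notMem f _ (fun h => h.2 h2), add_zero]
  · rw [restr_apply_of_mem f hY h1, restr_apply_of_notMem f _ (fun h => h2 h.2),
      restr_apply_of_mem f (hY.diff hX) ⟨h1, h2⟩, zero_add]
  all_goals
    rw [restr_apply_of_notMem f hY h1, restr_apply_of_notMem f _ (fun h => h1 h.1),
      restr_apply_of_notMem f _ (fun h => h1 h.1), add_zero]

/-- Membership in a submodule may be checked locally on the base groupoid, because compactness
of the support reduces to finitely many disjoint clopen pieces. -/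
theorem mem_of_forall_restr_mem (N : Submodule R (tw.Steinberg R)) (f : tw.Steinberg R)
    (h : ∀ a ∈ tw.suppG f.toFun, ∃ X : Set G, IsClopen X ∧ a ∈ X ∧
      ∀ (Y : Set G) (hY : IsClopen Y), Y ⊆ X → f.restr hY ∈ N) : f ∈ N := by
  obtain ⟨X, -, hfX, hN⟩ := f.isCompact_suppG.induction_on
    (p := fun K => ∃ X : Set G, IsClopen X ∧ K ⊆ X ∧
      ∀ (Y : Set G) (hY : IsClopen Y), Y ⊆ X → f.restr hY ∈ N)
    ⟨∅, isClopen_empty, Subset.rfl, fun Y hY hY' => by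
      have h0 : f.restr hY = 0 := by
        ext σ
        exact restr_apply_of_notMem f hY fun hσ => hY' hσ
      rw [h0]
      exact N.zero_mem⟩
    (fun s t hst ⟨X, hX, htX, hN⟩ => ⟨X, hX, hst.trans htX, hN⟩)
    (fun s t ⟨X, hX, hsX, hN⟩ ⟨X', hX', htX, hN'⟩ =>
      ⟨X ∪ X', hX.union hX', union_subset_union hsX htX, fun Y hY hYX => by
        rw [restr_eq_add f hX hY]
        exact N.add_mem (hN _ _ inter_subset_right)
          (hN' _ _ fun y hy => (hYX hy.1).resolve_left hy.2)⟩)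
    (fun a ha => by
      obtain ⟨X, hX, haX, hN⟩ := h a ha
      exact ⟨X, mem_nhdsWithin_of_mem_nhds (hX.isOpen.mem_nhds haX), X, hX, Subset.rfl, hN⟩)
  rw [← restr_eq_self f f.isClopen_suppG Subset.rfl]
  exact hN _ _ hfX

/-- Elements that are unit-valued on their support and whose support lies over a bisection. -/
structure IsMonomial (u : tw.Steinberg R) : Prop where
  isUnit : ∀ σ, u.toFun σ ≠ 0 → IsUnit (u.toFun σ)
  injOn_rng : InjOn rng (tw.suppG u.toFun)
  injOn_src : InjOn src (tw.suppG u.toFun)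

theorem IsMonomial.restr {u : tw.Steinberg R} (hu : u.IsMonomial) {X : Set G}
    (hX : IsClopen X) : (u.restr hX).IsMonomial where
  isUnit σ hσ := by
    have hX' : tw.q σ ∈ X := by
      by_contra h
      exact hσ (restr_apply_of_notMem u hX h)
    rw [restr_apply_of_mem u hX hX'] at hσ ⊢
    exact hu.isUnit σ hσ
  injOn_rng := hu.injOn_rng.mono (by rw [suppG_restr]; exact inter_subset_left)
  injOn_src := hu.injOn_src.mono (by rw [suppG_restr]; exact inter_subset_left)

/-- Each arrow of the total groupoid has a monomial taking the value one there and supported in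
a prescribed neighbourhood: the reciprocal of the fibre coordinate of a local trivialisation. -/
theorem exists_isMonomial [T2Space G] [IsAmple G] (σ₀ : S) {U : Set G} (hU : IsOpen U)
    (hσ₀ : tw.q σ₀ ∈ U) :
    ∃ u : tw.Steinberg R, u.IsMonomial ∧ tw.suppG u.toFun ⊆ U ∧ u.toFun σ₀ = 1 := by
  classical
  obtain ⟨B, P, haB, hB, hP, hqP, he, hr⟩ := tw.locally_trivial (tw.q σ₀)
  obtain ⟨K, ⟨hKc, hK⟩, haK, hKU⟩ :=
    (IsAmple.isTopologicalBasis (G := G)).exists_subset_of_mem_open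
      (show tw.q σ₀ ∈ B ∩ U from ⟨haB, hσ₀⟩) (hB.isOpen.inter hU)
  have hKcl : IsClopen K := ⟨hKc.isClosed, hK.isOpen⟩
  have hact : (fun p : B × Rˣ => tw.i (⟨rng p.1.1, rng_mem_units p.1.1⟩, p.2) * P p.1) =
      fun p => tw.act p.2 (P p.1) := by
    funext p
    simp only [act, hqP]
  rw [hact] at he hr
  have ho : IsOpenEmbedding fun p : B × Rˣ => tw.act p.2 (P p.1) :=
    ⟨he, by rw [hr]; exact hB.isOpen.preimage tw.continuous_q⟩
  have hex : ∀ σ : S, tw.q σ ∈ K → ∃ t : Rˣ, ∀ h : tw.q σ ∈ B, σ = tw.act t (P ⟨tw.q σ, h⟩) := by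
    intro σ hσ
    obtain ⟨t, ht⟩ := tw.exists_act (σ := P ⟨tw.q σ, (hKU hσ).1⟩) (τ := σ) (hqP _)
    exact ⟨t, fun _ => ht⟩
  choose! c hc using hex
  have hc' : ∀ (b : B) (t : Rˣ), b.1 ∈ K → c (tw.act t (P b)) = t := by
    intro b t hb
    have hq : tw.q (tw.act t (P b)) = b.1 := by rw [tw.q_act, hqP]
    have h1 := hc (tw.act t (P b)) (by rwa [hq]) (by rw [hq]; exact b.2)
    have h2 : (⟨tw.q (tw.act t (P b)), by rw [hq]; exact b.2⟩ : B) = b := Subtype.ext hq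
    rw [h2] at h1
    exact (tw.act_injective h1).symm
  -- the coordinate of `σ` divided by the coordinate of `σ₀`
  set v : S → R := (tw.q ⁻¹' K).indicator fun σ => (↑(c σ₀ * (c σ)⁻¹) : R) with hv
  have hv1 : ∀ σ, tw.q σ ∈ K → v σ = (↑(c σ₀ * (c σ)⁻¹) : R) := fun σ h =>
    indicator_of_mem (s := tw.q ⁻¹' K) h _
  have hv0 : ∀ σ, tw.q σ ∉ K → v σ = 0 := fun σ h =>
    indicator_of_notMem (s := tw.q ⁻¹' K) h _
  have hlc : IsLocallyConstant v := by
    rw [IsLocallyConstant.iff_eventually_eq]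
    intro σ
    by_cases hσ : tw.q σ ∈ K
    · have hσB := (hKU hσ).1
      have hopen : IsOpen ((fun p : B × Rˣ => tw.act p.2 (P p.1)) ''
          ((Subtype.val ⁻¹' K) ×ˢ {c σ})) :=
        ho.isOpenMap _ ((hK.isOpen.preimage continuous_subtype_val).prod (isOpen_discrete _))
      have hmem : σ ∈ (fun p : B × Rˣ => tw.act p.2 (P p.1)) ''
          ((Subtype.val ⁻¹' K) ×ˢ {c σ}) :=
        ⟨(⟨tw.q σ, hσB⟩, c σ), ⟨hσ, rfl⟩, (hc σ hσ hσB).symm⟩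
      filter_upwards [hopen.mem_nhds hmem]
      rintro _ ⟨⟨b, t⟩, ⟨hb, ht⟩, rfl⟩
      have hb' : b.1 ∈ K := hb
      have ht' : t = c σ := ht
      rw [hv1 _ (by rw [tw.q_act, hqP]; exact hb'), hv1 _ hσ, hc' b t hb', ht']
    · filter_upwards [(hKcl.compl.isOpen.preimage tw.continuous_q).mem_nhds hσ] with τ hτ
      rw [hv0 _ hσ, hv0 _ hτ]
  have hcontra : tw.IsContravariant v := by
    intro t σ
    by_cases hσ : tw.q σ ∈ K
    · have hσB := (hKU hσ).1
      have h1 : tw.act t σ = tw.act (t * c σ) (P ⟨tw.q σ, hσB⟩) := by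
        rw [← tw.act_act, ← hc σ hσ hσB]
      rw [hv1 _ (by rwa [tw.q_act]), hv1 _ hσ, h1, hc' _ _ hσ, ← Units.val_mul]
      congr 1
      rw [mul_inv]
      exact mul_left_comm _ _ _
    · rw [hv0 _ (by rwa [tw.q_act]), hv0 _ hσ, mul_zero]
  have hsub : tw.suppG v ⊆ K := by
    rintro _ ⟨σ, hσ, rfl⟩
    by_contra h
    exact hσ (hv0 _ h)
  refine ⟨⟨v, hlc, hcontra, isCompact_suppG_of_subset hcontra hlc hKc hsub⟩, ⟨?_, ?_, ?_⟩,
    hsub.trans (hKU.trans inter_subset_right), ?_⟩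
  · intro σ hσ
    change IsUnit (v σ)
    have : tw.q σ ∈ K := by
      by_contra h
      exact hσ (hv0 _ h)
    rw [hv1 σ this]
    exact Units.isUnit _
  · exact hK.injOn_rng.mono hsub
  · exact hK.injOn_src.mono hsub
  · change v σ₀ = 1
    rw [hv1 _ haK, _root_.mul_inv_cancel, Units.val_one]

/-- If every arrow has a neighbourhood such that all monomials supported in it belong to the
submodule `N`, then `N` is the whole algebra. -/
theorem eq_top_of_isMonomial_mem [T2Space G] [IsAmple G] (N : Submodule R (tw.Steinberg R))
    (h : ∀ a : G, ∃ U : Set G, IsOpen U ∧ a ∈ U ∧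
      ∀ u : tw.Steinberg R, u.IsMonomial → tw.suppG u.toFun ⊆ U → u ∈ N) : N = ⊤ := by
  refine eq_top_iff.2 fun f _ => mem_of_forall_restr_mem N f ?_
  rintro _ ⟨σ, hσ, rfl⟩
  obtain ⟨U, hU, hσU, hN⟩ := h (tw.q σ)
  obtain ⟨u, hu, huU, hu1⟩ := exists_isMonomial (R := R) (tw := tw) σ hU hσU
  set g : tw.Steinberg R := f - f.toFun σ • u with hg
  have hgv : ∀ τ, g.toFun τ = f.toFun τ - f.toFun σ * u.toFun τ := fun τ => rfl
  refine ⟨(tw.suppG g.toFun)ᶜ, g.isClopen_suppG.compl, ?_, ?_⟩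
  · rw [mem_compl_iff, q_mem_suppG_iff, hgv, hu1, mul_one, sub_self]
    exact not_not.2 rfl
  · intro Y hY hYX
    have h1 : f.restr hY = f.toFun σ • u.restr hY := by
      ext τ
      rw [toFun_smul, Pi.smul_apply, smul_eq_mul]
      by_cases hτ : tw.q τ ∈ Y
      · rw [restr_apply_of_mem f hY hτ, restr_apply_of_mem u hY hτ]
        have h2 := hYX hτ
        rw [mem_compl_iff, q_mem_suppG_iff, not_not, hgv] at h2
        exact sub_eq_zero.1 h2
      · rw [restr_apply_of_notMem f hY hτ, restr_apply_of_notMem u hY hτ, mul_zero]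
    rw [h1]
    refine N.smul_mem _ (hN _ (hu.restr hY) ?_)
    rw [suppG_restr]
    exact inter_subset_left.trans huU

end Steinberg

end DiscreteTwist

/-! ### Evaluating products -/

namespace DiscreteTwist

namespace Steinberg

variable {R G S : Type*} [CommRing R] [TopologicalSpace Rˣ] [DiscreteTopology Rˣ]
  [ArrowGroupoid G] [TopologicalSpace G] [IsTopological G] [T2Space G] [IsAmple G]
  [ArrowGroupoid S] [TopologicalSpace S] [IsTopological S]
  {tw : DiscreteTwist Rˣ G S}

/-- A convolution in which at most one term can be nonzero. -/
theorem mul_apply_of_unique (f g : tw.Steinberg R) {σ τ : S} (hr : rng (tw.q τ) = rng (tw.q σ))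
    (h : ∀ ρ, rng (tw.q ρ) = rng (tw.q σ) → f.toFun ρ ≠ 0 → g.toFun (ρ⁻¹ * σ) ≠ 0 →
      tw.q τ = tw.q ρ) :
    (f * g).toFun σ = f.toFun τ * g.toFun (τ⁻¹ * σ) := by
  rw [toFun_mul, conv_eq_sum f.contravariant g.contravariant ({()} : Finset Unit) (fun _ => τ)
    (fun _ _ => hr) (fun _ _ _ _ _ => rfl) (fun ρ h1 h2 h3 => ⟨(), by simp, h ρ h1 h2 h3⟩)]
  simp

theorem mul_apply_of_injOn_rng {f : tw.Steinberg R} (hf : InjOn rng (tw.suppG f.toFun))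
    (g : tw.Steinberg R) {τ ρ : S} (hτ : f.toFun τ ≠ 0) (hc : Composable τ ρ) :
    (f * g).toFun (τ * ρ) = f.toFun τ * g.toFun ρ := by
  have hr : rng (tw.q τ) = rng (tw.q (τ * ρ)) := by
    rw [tw.q_hom.map_mul hc, rng_mul (tw.q_hom.composable hc)]
  rw [mul_apply_of_unique f g hr fun π h1 h2 _ =>
    hf ⟨τ, hτ, rfl⟩ ⟨π, h2, rfl⟩ (hr.trans h1.symm), inv_mul_cancel hc]

theorem mul_apply_of_injOn_src (f : tw.Steinberg R) {g : tw.Steinberg R}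
    (hg : InjOn src (tw.suppG g.toFun)) {τ ρ : S} (hρ : g.toFun ρ ≠ 0) (hc : Composable τ ρ) :
    (f * g).toFun (τ * ρ) = f.toFun τ * g.toFun ρ := by
  have hr : rng (tw.q τ) = rng (tw.q (τ * ρ)) := by
    rw [tw.q_hom.map_mul hc, rng_mul (tw.q_hom.composable hc)]
  rw [mul_apply_of_unique f g hr, inv_mul_cancel hc]
  intro π h1 _ h3
  have hπ : Composable π⁻¹ (τ * ρ) := tw.composable_inv_of_rng h1
  have h4 : tw.q (π⁻¹ * (τ * ρ)) = tw.q ρ := by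
    refine hg ⟨_, h3, rfl⟩ ⟨ρ, hρ, rfl⟩ ?_
    rw [← tw.q_hom.map_src, ← tw.q_hom.map_src, src_mul hπ, src_mul hc]
  have hc' : Composable (tw.q τ) (tw.q ρ) := tw.q_hom.composable hc
  have h5 : tw.q (τ * ρ) = tw.q π * tw.q ρ := by
    rw [← h4, tw.q_hom.map_mul hπ, tw.q_hom.map_inv, mul_inv_mul h1]
  have h6 : Composable (tw.q π) (tw.q ρ) := by
    have h7 : rng (tw.q (π⁻¹ * (τ * ρ))) = src (tw.q π) := by
      rw [tw.q_hom.map_mul hπ, rng_mul (tw.q_hom.composable hπ), tw.q_hom.map_inv, rng_inv]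
    rw [h4] at h7
    exact h7.symm
  rw [← mul_inv_cancel hc', ← mul_inv_cancel h6, ← h5, tw.q_hom.map_mul hc]

theorem exists_mul_of_mul_ne_zero {f g : tw.Steinberg R} {σ : S} (h : (f * g).toFun σ ≠ 0) :
    ∃ a ∈ tw.suppG f.toFun, ∃ b ∈ tw.suppG g.toFun, Composable a b ∧ tw.q σ = a * b :=
  exists_mul_of_conv_ne_zero h

theorem mem_diagonal_iff {f : tw.Steinberg R} :
    f ∈ diagonal R tw ↔ tw.suppG f.toFun ⊆ units G := Iff.rfl

theorem apply_eq_zero_of_mem_diagonal {c : tw.Steinberg R} (hc : c ∈ diagonal R tw) {σ : S}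
    (h : tw.q σ ∉ units G) : c.toFun σ = 0 := by
  by_contra hne
  exact h (hc ⟨σ, hne, rfl⟩)

theorem diagonal_mul_apply {c : tw.Steinberg R} (hc : c ∈ diagonal R tw) (g : tw.Steinberg R)
    (σ : S) : (c * g).toFun σ = c.toFun (rng σ) * g.toFun σ := by
  have hr : rng (tw.q (rng σ)) = rng (tw.q σ) := by rw [tw.q_hom.map_rng, rng_rng]
  rw [mul_apply_of_unique c g hr, inv_of_mem_units (rng_mem_units σ), rng_mul_self]
  intro ρ h1 h2 _
  have h3 : tw.q ρ ∈ units G := hc ⟨ρ, h2, rfl⟩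
  rw [tw.q_hom.map_rng, ← h1, rng_of_mem_units h3]

theorem mul_diagonal_apply (f : tw.Steinberg R) {c : tw.Steinberg R} (hc : c ∈ diagonal R tw)
    (σ : S) : (f * c).toFun σ = f.toFun σ * c.toFun (src σ) := by
  rw [mul_apply_of_unique f c rfl]
  · rfl
  · intro ρ h1 _ h3
    exact ((tw.q_inv_mul_mem_units_iff h1).1 (hc ⟨_, h3, rfl⟩)).symm

/-- Elements of the diagonal are determined by their values on the units of the total
groupoid. -/
theorem diagonal_ext {c d : tw.Steinberg R} (hc : c ∈ diagonal R tw) (hd : d ∈ diagonal R tw)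
    (h : ∀ x ∈ units S, c.toFun x = d.toFun x) : c = d := by
  ext σ
  by_cases hσ : tw.q σ ∈ units G
  · obtain ⟨t, ht⟩ := tw.exists_act (tw.q_rng_of_q_mem hσ)
    rw [ht, toFun_act, toFun_act, h _ (rng_mem_units σ)]
  · rw [apply_eq_zero_of_mem_diagonal hc hσ, apply_eq_zero_of_mem_diagonal hd hσ]

theorem diagonal_comm {c d : tw.Steinberg R} (hc : c ∈ diagonal R tw)
    (hd : d ∈ diagonal R tw) : c * d = d * c := by
  refine diagonal_ext ((diagonal R tw).mul_mem hc hd) ((diagonal R tw).mul_mem hd hc)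
    fun x hx => ?_
  rw [diagonal_mul_apply hc, diagonal_mul_apply hd, rng_of_mem_units hx, mul_comm]

/-! ### Idempotents of the diagonal -/

theorem idempotent_apply (hR : ∀ e : R, e * e = e → e = 0 ∨ e = 1) {e : tw.Steinberg R}
    (he : e ∈ idempotents (diagonal R tw)) {x : S} (hx : x ∈ units S) :
    e.toFun x = 0 ∨ e.toFun x = 1 := by
  refine hR _ ?_
  have h := diagonal_mul_apply he.1 e x
  rwa [he.2, rng_of_mem_units hx, eq_comm] at h

theorem mem_idempotents_of_apply {e : tw.Steinberg R} (he : e ∈ diagonal R tw)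
    (h : ∀ x ∈ units S, e.toFun x = 0 ∨ e.toFun x = 1) : e ∈ idempotents (diagonal R tw) := by
  refine ⟨he, diagonal_ext ((diagonal R tw).mul_mem he he) he fun x hx => ?_⟩
  rw [diagonal_mul_apply he, rng_of_mem_units hx]
  rcases h x hx with h | h <;> simp [h]

/-- The indicator function of a compact open set of units, an idempotent of the diagonal. -/
theorem exists_indicator {K : Set G} (hK : IsCompact K) (hKo : IsOpen K) (hKu : K ⊆ units G) :
    ∃ e : tw.Steinberg R, e ∈ diagonal R tw ∧
      (∀ x ∈ units S, tw.q x ∈ K → e.toFun x = 1) ∧ tw.suppG e.toFun ⊆ K := by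
  classical
  rcases subsingleton_or_nontrivial R with hR | hR
  · refine ⟨0, (diagonal R tw).zero_mem, fun _ _ _ => Subsingleton.elim _ _, ?_⟩
    rintro _ ⟨σ, hσ, rfl⟩
    exact absurd rfl hσ
  have hKcl : IsClopen K := ⟨hK.isClosed, hKo⟩
  have hex : ∀ σ : S, tw.q σ ∈ K → ∃ t : Rˣ, σ = tw.act t (rng σ) := fun σ hσ =>
    tw.exists_act (tw.q_rng_of_q_mem (hKu hσ))
  choose! c hc using hex
  set v : S → R := (tw.q ⁻¹' K).indicator fun σ => (↑(c σ)⁻¹ : R) with hv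
  have hv1 : ∀ σ, tw.q σ ∈ K → v σ = (↑(c σ)⁻¹ : R) := fun σ h =>
    indicator_of_mem (s := tw.q ⁻¹' K) h _
  have hv0 : ∀ σ, tw.q σ ∉ K → v σ = 0 := fun σ h =>
    indicator_of_notMem (s := tw.q ⁻¹' K) h _
  have hsub : tw.suppG v ⊆ K := by
    rintro _ ⟨σ, hσ, rfl⟩
    by_contra h
    exact hσ (hv0 _ h)
  have hcontra : tw.IsContravariant v := by
    intro t σ
    by_cases hσ : tw.q σ ∈ K
    · have hσ' : tw.q (tw.act t σ) ∈ K := by rwa [tw.q_act]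
      have h1 : tw.act (c (tw.act t σ)) (rng σ) = tw.act (t * c σ) (rng σ) := by
        rw [← tw.act_act, ← hc σ hσ, ← tw.rng_act t σ, ← hc _ hσ']
      rw [hv1 _ hσ', hv1 _ hσ, tw.act_injective h1, ← Units.val_mul, mul_inv]
    · rw [hv0 _ (by rwa [tw.q_act]), hv0 _ hσ, mul_zero]
  have hlc : IsLocallyConstant v := by
    rw [IsLocallyConstant.iff_eventually_eq]
    intro σ
    by_cases hσ : tw.q σ ∈ K
    · -- near `σ`, the function is the quotient of a monomial by its values on units
      obtain ⟨u, hu, huK, hu1⟩ := exists_isMonomial (R := R) (tw := tw) σ hKo hσ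
      have hcont : Continuous (rng : S → S) := continuous_rng
      have hw : IsLocallyConstant fun τ => u.toFun τ * Ring.inverse (u.toFun (rng τ)) :=
        u.locallyConstant.mul ((u.locallyConstant.comp_continuous hcont).comp Ring.inverse)
      have hval : ∀ τ, tw.q τ ∈ tw.suppG u.toFun →
          v τ = u.toFun τ * Ring.inverse (u.toFun (rng τ)) := by
        intro τ hτ
        have hτK := huK hτ
        have h2 : u.toFun (rng τ) ≠ 0 := by
          rwa [← q_mem_suppG_iff, tw.q_rng_of_q_mem (hKu hτK)]
        have h3 : u.toFun τ = (↑(c τ)⁻¹ : R) * u.toFun (rng τ) := by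
          conv_lhs => rw [hc τ hτK]
          exact toFun_act u _ _
        rw [hv1 τ hτK, h3, mul_assoc, Ring.mul_inverse_cancel _ (hu.isUnit _ h2), mul_one]
      have hmem : tw.q σ ∈ tw.suppG u.toFun := by
        rw [q_mem_suppG_iff, hu1]
        exact one_ne_zero
      filter_upwards [hw.eventually_eq σ,
        (u.isClopen_suppG.isOpen.preimage tw.continuous_q).mem_nhds hmem] with τ h1 h2
      rw [hval τ h2, hval σ hmem, h1]
    · filter_upwards [(hKcl.compl.isOpen.preimage tw.continuous_q).mem_nhds hσ] with τ hτ
      rw [hv0 _ hσ, hv0 _ hτ]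
  refine ⟨⟨v, hlc, hcontra, isCompact_suppG_of_subset hcontra hlc hK hsub⟩,
    hsub.trans hKu, ?_, hsub⟩
  intro x hx hxK
  have h1 := hc x hxK
  rw [rng_of_mem_units hx] at h1
  have h2 : tw.act (c x) x = tw.act 1 x := by rw [← h1, tw.act_one]
  change v x = 1
  rw [hv1 x hxK, tw.act_injective h2, inv_one, Units.val_one]

end Steinberg

end DiscreteTwist

/-! ### Products of normalisers -/

namespace AlgebraicPair

variable {R A : Type*} [CommRing R] [NonUnitalRing A] [Module R A]
  {C : NonUnitalSubalgebra R A}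

theorem IsNormaliserInverse.symm {n m : A} (h : IsNormaliserInverse C n m) :
    IsNormaliserInverse C m n :=
  ⟨h.mul_right, h.mul_left, h.conj_mem', h.conj_mem⟩

theorem IsNormaliserInverse.mul_mem (hC : IsBasicPair C) {n m : A}
    (h : IsNormaliserInverse C n m) : m * n ∈ C := by
  obtain ⟨e, he, hu⟩ := hC.local_units {n}
  have h1 := h.conj_mem e he.1
  rwa [mul_assoc, (hu n (Finset.mem_singleton_self n)).1] at h1

theorem mul_mem_normalisers (hC : IsBasicPair C) {n n' : A} (hn : n ∈ normalisers C)
    (hn' : n' ∈ normalisers C) : n * n' ∈ normalisers C := by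
  obtain ⟨m, hm⟩ := hn
  obtain ⟨m', hm'⟩ := hn'
  have hcomm := hC.comm _ (hm.mul_mem hC) _ (hm'.symm.mul_mem hC)
  refine ⟨m' * m, ?_, ?_, fun c hc => ?_, fun c hc => ?_⟩
  · calc m' * m * (n * n') * (m' * m) = m' * ((m * n) * (n' * m')) * m := by
          simp only [mul_assoc]
      _ = (m' * n' * m') * (m * n * m) := by rw [hcomm]; simp only [mul_assoc]
      _ = m' * m := by rw [hm'.mul_left, hm.mul_left]
  · calc n * n' * (m' * m) * (n * n') = n * ((n' * m') * (m * n)) * n' := by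
          simp only [mul_assoc]
      _ = (n * m * n) * (n' * m' * n') := by rw [← hcomm]; simp only [mul_assoc]
      _ = n * n' := by rw [hm'.mul_right, hm.mul_right]
  · have h1 := hm'.conj_mem _ (hm.conj_mem c hc)
    simpa only [mul_assoc] using h1
  · have h1 := hm.conj_mem' _ (hm'.conj_mem' c hc)
    simpa only [mul_assoc] using h1

end AlgebraicPair

namespace DiscreteTwist

namespace Steinberg

variable {R G S : Type*} [CommRing R] [TopologicalSpace Rˣ] [DiscreteTopology Rˣ]
  [ArrowGroupoid G] [TopologicalSpace G] [IsTopological G] [T2Space G] [IsAmple G]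
  [ArrowGroupoid S] [TopologicalSpace S] [IsTopological S]
  {tw : DiscreteTwist Rˣ G S}

/-! ### Monomials are normalisers -/

omit [T2Space G] [IsAmple G] in
/-- The function whose value at `σ` is the reciprocal, or the junk value zero, of the value of
`u` at `σ⁻¹`. -/
theorem exists_pointwise_inverse (u : tw.Steinberg R) :
    ∃ v : tw.Steinberg R, (∀ σ, v.toFun σ = Ring.inverse (u.toFun σ⁻¹)) ∧
      tw.suppG v.toFun ⊆ Inv.inv ⁻¹' tw.suppG u.toFun := by
  set w : S → R := fun σ => Ring.inverse (u.toFun σ⁻¹) with hw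
  have hlc : IsLocallyConstant w :=
    (u.locallyConstant.comp_continuous continuous_inv').comp Ring.inverse
  have hcontra : tw.IsContravariant w := by
    intro t σ
    simp only [hw]
    rw [tw.act_inv, toFun_act, Ring.mul_inverse_rev, inv_inv, Ring.inverse_unit, mul_comm]
  have hsub : tw.suppG w ⊆ Inv.inv ⁻¹' tw.suppG u.toFun := by
    rintro _ ⟨σ, hσ, rfl⟩
    refine ⟨σ⁻¹, fun h0 => hσ ?_, tw.q_hom.map_inv σ⟩
    simp only [hw, h0, Ring.inverse_zero]
  have hcpt : IsCompact (Inv.inv ⁻¹' tw.suppG u.toFun) := by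
    have h := u.isCompact_suppG.image (continuous_inv' (G := G))
    convert h using 1
    ext a
    constructor
    · intro ha
      exact ⟨a⁻¹, ha, inv_inv_eq a⟩
    · rintro ⟨b, hb, rfl⟩
      rw [mem_preimage, inv_inv_eq]
      exact hb
  exact ⟨⟨w, hlc, hcontra, isCompact_suppG_of_subset hcontra hlc hcpt hsub⟩,
    fun _ => rfl, hsub⟩

/-- A monomial is a normaliser, and it admits an inverse supported on the inverse bisection. -/
theorem IsMonomial.exists_isNormaliserInverse {u : tw.Steinberg R} (hu : u.IsMonomial) :
    ∃ v : tw.Steinberg R, IsNormaliserInverse (diagonal R tw) u v ∧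
      tw.suppG v.toFun ⊆ Inv.inv ⁻¹' tw.suppG u.toFun := by
  obtain ⟨v, hv, hsub⟩ := u.exists_pointwise_inverse
  have hconj : ∀ w : tw.Steinberg R, tw.suppG w.toFun ⊆ tw.suppG u.toFun →
      v * w ∈ diagonal R tw := by
    rintro w hw _ ⟨σ, hσ, rfl⟩
    obtain ⟨a, ha, b, hb, hab, e⟩ := exists_mul_of_mul_ne_zero hσ
    have h1 : rng a⁻¹ = rng b := by rw [rng_inv]; exact hab
    rw [e, ← hu.injOn_rng (hsub ha) (hw hb) h1]
    exact rng_mem_units a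
  have hconj' : ∀ w : tw.Steinberg R, tw.suppG w.toFun ⊆ Inv.inv ⁻¹' tw.suppG u.toFun →
      u * w ∈ diagonal R tw := by
    rintro w hw _ ⟨σ, hσ, rfl⟩
    obtain ⟨a, ha, b, hb, hab, e⟩ := exists_mul_of_mul_ne_zero hσ
    have h1 : src a = src b⁻¹ := by rw [src_inv]; exact hab
    rw [e, hu.injOn_src ha (hw hb) h1]
    exact src_mem_units b
  have hinj : InjOn rng (tw.suppG v.toFun) := by
    intro a ha b hb h
    have h1 := hu.injOn_src (hsub ha) (hsub hb) (by rw [src_inv, src_inv, h])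
    rw [← inv_inv_eq a, h1, inv_inv_eq]
  have hvu : v * u ∈ diagonal R tw := hconj u Subset.rfl
  have hone : ∀ σ, u.toFun σ ≠ 0 → (v * u).toFun (src σ) = 1 := by
    intro σ hσ
    by_cases h0 : v.toFun σ⁻¹ = 0
    · rw [hv, inv_inv_eq] at h0
      have h1 := Ring.inverse_mul_cancel _ (hu.isUnit σ hσ)
      rw [h0, zero_mul] at h1
      exact absurd (by rw [← mul_one (u.toFun σ), ← h1, mul_zero]) hσ
    · have h1 := mul_apply_of_injOn_rng hinj u h0 (composable_inv_left σ)
      rw [hv, inv_inv_eq, Ring.inverse_mul_cancel _ (hu.isUnit σ hσ)] at h1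
      exact h1
  refine ⟨v, ⟨?_, ?_, fun c hc => ?_, fun c hc => ?_⟩, hsub⟩
  · ext σ
    rw [diagonal_mul_apply hvu]
    by_cases h0 : u.toFun σ⁻¹ = 0
    · rw [hv, h0, Ring.inverse_zero, mul_zero]
    · have h1 := hone _ h0
      rw [src_inv] at h1
      rw [h1, one_mul]
  · ext σ
    rw [mul_assoc, mul_diagonal_apply u hvu]
    by_cases h0 : u.toFun σ = 0
    · rw [h0, zero_mul]
    · rw [hone _ h0, mul_one]
  · rw [mul_assoc]
    refine hconj _ ?_
    rintro _ ⟨σ, hσ, rfl⟩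
    have hσ' : (c * u).toFun σ ≠ 0 := hσ
    rw [diagonal_mul_apply hc] at hσ'
    exact ⟨σ, right_ne_zero_of_mul hσ', rfl⟩
  · rw [mul_assoc]
    refine hconj' _ ?_
    rintro _ ⟨σ, hσ, rfl⟩
    have hσ' : (c * v).toFun σ ≠ 0 := hσ
    rw [diagonal_mul_apply hc] at hσ'
    exact hsub ⟨σ, right_ne_zero_of_mul hσ', rfl⟩

theorem IsMonomial.mem_normalisers {u : tw.Steinberg R} (hu : u.IsMonomial) :
    u ∈ normalisers (diagonal R tw) :=
  let ⟨v, hv, _⟩ := hu.exists_isNormaliserInverse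
  ⟨v, hv⟩

/-- A monomial supported on a bisection with disjoint range and source is a free normaliser. -/
theorem IsMonomial.mem_freeNormalisers {u : tw.Steinberg R} (hu : u.IsMonomial)
    (hd : ∀ a ∈ tw.suppG u.toFun, ∀ b ∈ tw.suppG u.toFun, src a ≠ rng b) :
    u ∈ freeNormalisers (diagonal R tw) := by
  refine ⟨hu.mem_normalisers, Or.inr ?_⟩
  obtain ⟨v, hv, hsub⟩ := hu.exists_isNormaliserInverse
  refine ⟨v, hv, ?_⟩
  ext σ
  by_contra hne
  obtain ⟨a, ha, b, hb, hab, -⟩ := exists_mul_of_mul_ne_zero hne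
  obtain ⟨τ, hτ, rfl⟩ := ha
  obtain ⟨ρ, hρ, rfl⟩ := hb
  obtain ⟨a₁, -, a₂, ha₂, h1, e1⟩ := exists_mul_of_mul_ne_zero hτ
  obtain ⟨b₁, hb₁, b₂, -, h2, e2⟩ := exists_mul_of_mul_ne_zero hρ
  refine hd a₂ ha₂ b₁ hb₁ ?_
  rw [← src_mul h1, ← e1, ← rng_mul h2, ← e2]
  exact hab

/-! ### The canonical expectation -/

variable (R tw) in
/-- The canonical conditional expectation onto the diagonal, restriction to the part of the
total groupoid over the unit space. -/
noncomputable def expectation : tw.Steinberg R →ₗ[R] diagonal R tw where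
  toFun f := ⟨f.restr isClopen_units, by
    rw [mem_diagonal_iff, suppG_restr]
    exact inter_subset_right⟩
  map_add' f g := Subtype.ext (toFun_injective (indicator_add _ _ _))
  map_smul' r f := Subtype.ext (toFun_injective
    (indicator_const_smul (tw.q ⁻¹' units G) r f.toFun :))

theorem expectation_coe (f : tw.Steinberg R) :
    (expectation R tw f : tw.Steinberg R) = f.restr isClopen_units := rfl

theorem expectation_of_mem {c : tw.Steinberg R} (hc : c ∈ diagonal R tw) :
    (expectation R tw c : tw.Steinberg R) = c :=
  restr_eq_self c isClopen_units hc

theorem isFaithfulExpectation_expectation :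
    IsFaithfulExpectation (diagonal R tw) (expectation R tw) where
  apply_coe c := Subtype.ext (expectation_of_mem c.2)
  bimodule a c c' := by
    apply Subtype.ext
    change ((c.1 * a * c'.1).restr isClopen_units : tw.Steinberg R) =
      c.1 * a.restr isClopen_units * c'.1
    ext σ
    rw [mul_diagonal_apply _ c'.2, diagonal_mul_apply c.2]
    by_cases hσ : tw.q σ ∈ units G
    · rw [restr_apply_of_mem _ _ hσ, restr_apply_of_mem _ _ hσ, mul_diagonal_apply _ c'.2,
        diagonal_mul_apply c.2]
    · rw [restr_apply_of_notMem _ _ hσ, restr_apply_of_notMem _ _ hσ, mul_zero, zero_mul]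
  faithful a ha := by
    obtain ⟨σ, hσ⟩ : ∃ σ, a.toFun σ ≠ 0 := by
      by_contra! h
      exact ha (Steinberg.ext h)
    obtain ⟨u, hu, -, hu1⟩ := exists_isMonomial (R := R) (tw := tw) σ⁻¹ isOpen_univ (mem_univ _)
    refine ⟨u, hu.mem_normalisers, fun h0 => hσ ?_⟩
    have h1 : ((u * a).restr isClopen_units : tw.Steinberg R).toFun (src σ) = 0 := by
      rw [← expectation_coe, h0]
      rfl
    rw [restr_apply_of_mem _ _ (tw.mem_units_of_q (src_mem_units σ))] at h1
    by_cases h2 : u.toFun σ⁻¹ = 0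
    · rw [← one_mul (a.toFun σ), ← hu1, h2, zero_mul]
    · have h3 := mul_apply_of_injOn_rng hu.injOn_rng a h2 (composable_inv_left σ)
      rw [hu1, one_mul] at h3
      exact h3.symm.trans h1

theorem span_idempotents_diagonal :
    Submodule.span R (idempotents (diagonal R tw)) = (diagonal R tw).toSubmodule := by
  refine le_antisymm (Submodule.span_le.2 fun e he => he.1) fun f hf => ?_
  have hf : f ∈ diagonal R tw := hf
  refine mem_of_forall_restr_mem _ f ?_
  rintro _ ⟨σ, hσ, rfl⟩
  have hσu : tw.q σ ∈ units G := hf ⟨σ, hσ, rfl⟩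
  obtain ⟨K, ⟨hKc, hK⟩, hσK, hKu⟩ :=
    (IsAmple.isTopologicalBasis (G := G)).exists_subset_of_mem_open hσu isClopen_units.isOpen
  obtain ⟨e, he, he1, -⟩ := exists_indicator (R := R) (tw := tw) hKc hK.isOpen hKu
  set r := f.toFun (rng σ) with hr
  set g : tw.Steinberg R := f - r • e with hg
  have hgv : ∀ τ, g.toFun τ = f.toFun τ - r * e.toFun τ := fun τ => rfl
  have hq : tw.q (rng σ) = tw.q σ := tw.q_rng_of_q_mem hσu
  refine ⟨K ∩ (tw.suppG g.toFun)ᶜ,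
    IsClopen.inter ⟨hKc.isClosed, hK.isOpen⟩ g.isClopen_suppG.compl, ⟨hσK, ?_⟩, ?_⟩
  · rw [mem_compl_iff, ← hq, q_mem_suppG_iff, hgv, he1 _ (rng_mem_units σ) (by rwa [hq]), mul_one,
      sub_self]
    exact not_not.2 rfl
  · intro Y hY hYX
    have h1 : f.restr hY = r • e.restr hY := by
      ext τ
      rw [toFun_smul, Pi.smul_apply, smul_eq_mul]
      by_cases hτ : tw.q τ ∈ Y
      · rw [restr_apply_of_mem f hY hτ, restr_apply_of_mem e hY hτ]
        have h2 := (hYX hτ).2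
        rw [mem_compl_iff, q_mem_suppG_iff, not_not, hgv] at h2
        exact sub_eq_zero.1 h2
      · rw [restr_apply_of_notMem f hY hτ, restr_apply_of_notMem e hY hτ, mul_zero]
    rw [h1]
    refine Submodule.smul_mem _ _ (Submodule.subset_span (mem_idempotents_of_apply ?_ ?_))
    · rw [mem_diagonal_iff, suppG_restr]
      exact inter_subset_left.trans he
    · intro x hx
      by_cases hxY : tw.q x ∈ Y
      · right
        rw [restr_apply_of_mem e hY hxY, he1 x hx (hYX hxY).1]
      · left
        exact restr_apply_of_notMem e hY hxY

theorem exists_local_unit (F : Finset (tw.Steinberg R)) :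
    ∃ e ∈ idempotents (diagonal R tw), ∀ a ∈ F, e * a = a ∧ a * e = a := by
  set K : Set G := ⋃ f ∈ F, (rng '' tw.suppG f.toFun ∪ src '' tw.suppG f.toFun) with hK
  have hKc : IsCompact K := F.isCompact_biUnion fun f _ =>
    (f.isCompact_suppG.image continuous_rng).union (f.isCompact_suppG.image continuous_src)
  have hKo : IsOpen K := isOpen_biUnion fun f _ =>
    (isOpenMap_rng _ f.isClopen_suppG.isOpen).union (isOpenMap_src _ f.isClopen_suppG.isOpen)
  have hKu : K ⊆ units G := by
    refine iUnion₂_subset fun f _ => union_subset ?_ ?_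
    · rintro _ ⟨a, -, rfl⟩
      exact rng_mem_units a
    · rintro _ ⟨a, -, rfl⟩
      exact src_mem_units a
  obtain ⟨e, he, he1, heK⟩ := exists_indicator (R := R) (tw := tw) hKc hKo hKu
  refine ⟨e, mem_idempotents_of_apply he fun x hx => ?_, fun f hf => ⟨?_, ?_⟩⟩
  · by_cases hxK : tw.q x ∈ K
    · exact Or.inr (he1 x hx hxK)
    · left
      by_contra hne
      exact hxK (heK ⟨x, hne, rfl⟩)
  · ext σ
    rw [diagonal_mul_apply he]
    by_cases h0 : f.toFun σ = 0
    · rw [h0, mul_zero]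
    · rw [he1 _ (rng_mem_units σ), one_mul]
      rw [tw.q_hom.map_rng]
      exact mem_biUnion hf (Or.inl ⟨_, ⟨σ, h0, rfl⟩, rfl⟩)
  · ext σ
    rw [mul_diagonal_apply _ he]
    by_cases h0 : f.toFun σ = 0
    · rw [h0, zero_mul]
    · rw [he1 _ (src_mem_units σ), mul_one]
      rw [tw.q_hom.map_src]
      exact mem_biUnion hf (Or.inr ⟨_, ⟨σ, h0, rfl⟩, rfl⟩)

variable (tw) in
theorem isBasicPair_diagonal (hR : ∀ e : R, e * e = e → e = 0 ∨ e = 1) :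
    IsBasicPair (diagonal R tw) where
  comm _ hc _ hd := diagonal_comm hc hd
  without_torsion e he hne t ht := by
    obtain ⟨x, hx, hx0⟩ : ∃ x ∈ units S, e.toFun x ≠ 0 := by
      by_contra! h
      exact hne (diagonal_ext he.1 (diagonal R tw).zero_mem h)
    have h1 : t * e.toFun x = 0 := congrFun (congrArg toFun ht) x
    rwa [(idempotent_apply hR he hx).resolve_left hx0, mul_one] at h1
  local_units := exists_local_unit
  span_idempotents := span_idempotents_diagonal
  span_normalisers := eq_top_of_isMonomial_mem _ fun _ =>
    ⟨univ, isOpen_univ, mem_univ _, fun _ hu _ => Submodule.subset_span hu.mem_normalisers⟩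
  exists_expectation := ⟨expectation R tw, isFaithfulExpectation_expectation⟩

/-! ### Principal and effective groupoids -/

variable (tw) in
theorem isADP_diagonal (hR : ∀ e : R, e * e = e → e = 0 ∨ e = 1) (hG : IsPrincipal G) :
    IsADP (diagonal R tw) where
  toIsBasicPair := isBasicPair_diagonal tw hR
  span_free := by
    refine eq_top_of_isMonomial_mem _ fun a => ?_
    by_cases ha : a ∈ units G
    · exact ⟨units G, isClopen_units.isOpen, ha, fun u hu huU =>
        Submodule.subset_span ⟨hu.mem_normalisers, Or.inl huU⟩⟩
    · have hne : src a ≠ rng a := fun h => ha (by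
        rw [← show isotropy G = units G from hG]
        exact h.symm)
      obtain ⟨V, W, hV, hW, haV, haW, hd⟩ := t2_separation hne
      refine ⟨src ⁻¹' V ∩ rng ⁻¹' W,
        (hV.preimage continuous_src).inter (hW.preimage continuous_rng), ⟨haV, haW⟩,
        fun u hu huU => Submodule.subset_span (hu.mem_freeNormalisers fun b hb c hc h => ?_)⟩
      exact hd.le_bot ⟨(huU hb).1, show src b ∈ W by rw [h]; exact (huU hc).2⟩

/-- An element commuting with the diagonal is supported on the isotropy. -/
theorem suppG_subset_isotropy {f : tw.Steinberg R}
    (hf : ∀ c ∈ diagonal R tw, c * f = f * c) : tw.suppG f.toFun ⊆ isotropy G := by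
  rintro _ ⟨σ, hσ, rfl⟩
  by_contra hne
  have hne : rng (tw.q σ) ≠ src (tw.q σ) := hne
  obtain ⟨K, ⟨hKc, hK⟩, hσK, hKu⟩ :=
    (IsAmple.isTopologicalBasis (G := G)).exists_subset_of_mem_open
      (show rng (tw.q σ) ∈ units G ∩ {src (tw.q σ)}ᶜ from ⟨rng_mem_units _, hne⟩)
      (isClopen_units.isOpen.inter isOpen_compl_singleton)
  obtain ⟨e, he, he1, heK⟩ := exists_indicator (R := R) (tw := tw) hKc hK.isOpen
    (hKu.trans inter_subset_left)
  have h1 := congrFun (congrArg toFun (hf e he)) σ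
  rw [diagonal_mul_apply he, mul_diagonal_apply _ he,
    he1 _ (rng_mem_units σ) (by rwa [tw.q_hom.map_rng]), one_mul] at h1
  have h2 : e.toFun (src σ) = 0 := by
    by_contra h
    refine (hKu (heK ⟨_, h, rfl⟩)).2 ?_
    rw [tw.q_hom.map_src]
    exact mem_singleton _
  rw [h2, mul_zero] at h1
  exact hσ h1

variable (tw) in
theorem isACP_diagonal (hR : ∀ e : R, e * e = e → e = 0 ∨ e = 1) (hG : IsEffective G) :
    IsACP (diagonal R tw) where
  toIsBasicPair := isBasicPair_diagonal tw hR
  maximal D hD hCD := by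
    refine le_antisymm (fun f hf => ?_) hCD
    rw [mem_diagonal_iff, ← show interior (isotropy G) = units G from hG]
    exact interior_maximal (suppG_subset_isotropy fun c hc => hD c (hCD hc) f hf)
      f.isClopen_suppG.isOpen

/-! ### Expectations implemented by idempotents -/

/-- An expectation implemented by idempotents is the canonical one. -/
theorem eq_expectation_of_isImplementedByIdempotents {P : tw.Steinberg R →ₗ[R] diagonal R tw}
    (hP : IsConditionalExpectation (diagonal R tw) P)
    (hI : IsImplementedByIdempotents (diagonal R tw) P) : P = expectation R tw := by
  have htop : LinearMap.eqLocus P (expectation R tw) = ⊤ := by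
    refine eq_top_of_isMonomial_mem _ fun a => ?_
    by_cases ha : a ∈ units G
    · refine ⟨units G, isClopen_units.isOpen, ha, fun u hu huU => ?_⟩
      have h1 : u ∈ diagonal R tw := huU
      rw [LinearMap.mem_eqLocus]
      exact (hP.apply_coe ⟨u, h1⟩).trans (Subtype.ext (expectation_of_mem h1).symm)
    · refine ⟨(units G)ᶜ, isClopen_units.compl.isOpen, ha, fun u hu huU => ?_⟩
      rw [LinearMap.mem_eqLocus]
      apply Subtype.ext
      obtain ⟨e, he, hPe, -⟩ := hI u hu.mem_normalisers
      ext σ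
      rw [expectation_coe]
      by_cases hσ : tw.q σ ∈ units G
      · have h0 : u.toFun σ = 0 := by
          by_contra hne
          exact huU ⟨σ, hne, rfl⟩ hσ
        rw [restr_apply_of_mem _ _ hσ, hPe, mul_diagonal_apply _ he.1, h0, zero_mul]
      · rw [restr_apply_of_notMem _ _ hσ, apply_eq_zero_of_mem_diagonal (P u).2 hσ]
  exact LinearMap.ext fun f => LinearMap.mem_eqLocus.1 (htop ▸ Submodule.mem_top)

/-- If the canonical expectation is implemented by idempotents and the support of a normaliser
contains a unit `x`, then it contains no other arrow with source or range `x`. -/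
theorem mem_units_of_implemented (hR : ∀ e : R, e * e = e → e = 0 ∨ e = 1)
    (hI : IsImplementedByIdempotents (diagonal R tw) (expectation R tw)) {w : tw.Steinberg R}
    (hw : w ∈ normalisers (diagonal R tw)) {σ : S} (hσ : w.toFun σ ≠ 0)
    (h : w.toFun (src σ) ≠ 0 ∨ w.toFun (rng σ) ≠ 0) : tw.q σ ∈ units G := by
  obtain ⟨e, he, hPe, hcomm⟩ := hI w hw
  have hone : ∀ x ∈ units S, w.toFun x ≠ 0 → e.toFun x = 1 := by
    intro x hx hwx
    refine (idempotent_apply hR he hx).resolve_left fun h0 => hwx ?_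
    rw [← restr_apply_of_mem w isClopen_units (tw.mem_units_of_q hx), ← expectation_coe, hPe,
      mul_diagonal_apply _ he.1, src_of_mem_units hx, h0, mul_zero]
  by_contra hu
  have h0 : (expectation R tw w : tw.Steinberg R).toFun σ = 0 :=
    apply_eq_zero_of_mem_diagonal (expectation R tw w).2 hu
  rcases h with h | h
  · rw [hPe, mul_diagonal_apply _ he.1, hone _ (src_mem_units σ) h, mul_one] at h0
    exact hσ h0
  · rw [hPe, hcomm, diagonal_mul_apply he.1, hone _ (rng_mem_units σ) h, one_mul] at h0
    exact hσ h0

variable (tw) in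
theorem isAQP_diagonal_iff (hR : ∀ e : R, e * e = e → e = 0 ∨ e = 1) :
    IsAQP (diagonal R tw) ↔ LocalBisectionHypothesis R tw := by
  have hB := isBasicPair_diagonal tw hR
  constructor
  · rintro ⟨-, P, hP, hI⟩ n hn
    rw [eq_expectation_of_isImplementedByIdempotents hP.toIsConditionalExpectation hI] at hI
    refine isOpenBisection_of_injOn n.isClopen_suppG.isOpen ?_ ?_
    · rintro _ ⟨σ, hσ, rfl⟩ _ ⟨τ, hτ, rfl⟩ h
      -- translate by a monomial at `σ⁻¹`, which moves `σ` to a unit and `τ` to `σ⁻¹ * τ`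
      obtain ⟨u, hu, -, hu1⟩ :=
        exists_isMonomial (R := R) (tw := tw) σ⁻¹ isOpen_univ (mem_univ _)
      have hu0 : u.toFun σ⁻¹ ≠ 0 := fun h0 => hσ (by
        rw [← one_mul (n.toFun σ), ← hu1, h0, zero_mul])
      have hc : Composable σ⁻¹ τ := tw.composable_inv_of_rng h
      refine (tw.q_inv_mul_mem_units_iff h).1
        (mem_units_of_implemented hR hI (mul_mem_normalisers hB hu.mem_normalisers hn) ?_ ?_)
      · rw [mul_apply_of_injOn_rng hu.injOn_rng n hu0 hc, hu1, one_mul]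
        exact hτ
      · right
        rw [rng_mul hc, rng_inv]
        change (u * n).toFun (σ⁻¹ * σ) ≠ 0
        rw [mul_apply_of_injOn_rng hu.injOn_rng n hu0 (composable_inv_left σ), hu1, one_mul]
        exact hσ
    · rintro _ ⟨σ, hσ, rfl⟩ _ ⟨τ, hτ, rfl⟩ h
      -- for sources, translate on the right, which moves `τ` to `τ * σ⁻¹`
      obtain ⟨u, hu, -, hu1⟩ :=
        exists_isMonomial (R := R) (tw := tw) σ⁻¹ isOpen_univ (mem_univ _)
      have hu0 : u.toFun σ⁻¹ ≠ 0 := fun h0 => hσ (by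
        rw [← one_mul (n.toFun σ), ← hu1, h0, zero_mul])
      have h' : rng (tw.q τ⁻¹) = rng (tw.q σ⁻¹) := by
        rw [tw.q_hom.map_inv, tw.q_hom.map_inv, rng_inv, rng_inv, h]
      have hc : Composable τ σ⁻¹ := by
        have := tw.composable_inv_of_rng h'
        rwa [inv_inv_eq] at this
      have h1 : tw.q (τ * σ⁻¹) ∈ units G := by
        refine mem_units_of_implemented hR hI
          (mul_mem_normalisers hB hn hu.mem_normalisers) ?_ ?_
        · rw [mul_apply_of_injOn_src n hu.injOn_src hu0 hc, hu1, mul_one]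
          exact hτ
        · left
          rw [src_mul hc, src_inv]
          change (n * u).toFun (σ * σ⁻¹) ≠ 0
          rw [mul_apply_of_injOn_src n hu.injOn_src hu0 (composable_inv_right σ), hu1, mul_one]
          exact hσ
      have h2 := tw.q_inv_mul_mem_units_iff h'
      rw [inv_inv_eq] at h2
      have h3 := h2.1 h1
      rw [tw.q_hom.map_inv, tw.q_hom.map_inv] at h3
      rw [← inv_inv_eq (tw.q σ), ← h3, inv_inv_eq]
  · intro hL
    refine ⟨hB, expectation R tw, isFaithfulExpectation_expectation, fun n hn => ?_⟩
    have hbis := hL n hn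
    have hK : IsClopen (tw.suppG n.toFun ∩ units G) := n.isClopen_suppG.inter isClopen_units
    obtain ⟨e, he, he1, heK⟩ := exists_indicator (R := R) (tw := tw)
      (n.isCompact_suppG.inter_right isClopen_units.isClosed) hK.isOpen inter_subset_right
    have he0 : ∀ x, tw.q x ∉ tw.suppG n.toFun → e.toFun x = 0 := fun x hx => by
      by_contra hne
      exact hx (heK ⟨x, hne, rfl⟩).1
    have hval : ∀ σ, ((expectation R tw n : tw.Steinberg R).toFun σ = (n * e).toFun σ) ∧
        (n * e).toFun σ = (e * n).toFun σ := by
      intro σ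
      rw [expectation_coe, mul_diagonal_apply _ he, diagonal_mul_apply he]
      by_cases h0 : n.toFun σ = 0
      · rw [h0, zero_mul, mul_zero]
        refine ⟨?_, rfl⟩
        by_cases hσ : tw.q σ ∈ units G
        · rw [restr_apply_of_mem _ _ hσ, h0]
        · rw [restr_apply_of_notMem _ _ hσ]
      · have hmem : tw.q σ ∈ tw.suppG n.toFun := ⟨σ, h0, rfl⟩
        by_cases hσ : tw.q σ ∈ units G
        · have hr : e.toFun (rng σ) = 1 := he1 _ (rng_mem_units σ) (by
            rw [tw.q_rng_of_q_mem hσ]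
            exact ⟨hmem, hσ⟩)
          rw [restr_apply_of_mem _ _ hσ, tw.src_eq_rng_of_q_mem hσ, hr, mul_one, one_mul]
          exact ⟨rfl, rfl⟩
        · -- the support is a bisection, so it contains neither end of a non-unit arrow in it
          have hs : e.toFun (src σ) = 0 := he0 _ fun h => hσ (by
            rw [tw.q_hom.map_src] at h
            rw [← hbis.injOn_src h hmem (src_src _)]
            exact src_mem_units _)
          have hr : e.toFun (rng σ) = 0 := he0 _ fun h => hσ (by
            rw [tw.q_hom.map_rng] at h
            rw [← hbis.injOn_rng h hmem (rng_rng _)]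
            exact rng_mem_units _)
          rw [restr_apply_of_notMem _ _ hσ, hs, hr, mul_zero, zero_mul]
          exact ⟨rfl, rfl⟩
    refine ⟨e, mem_idempotents_of_apply he fun x hx => ?_,
      Steinberg.ext fun σ => (hval σ).1, Steinberg.ext fun σ => (hval σ).2⟩
    by_cases hxn : tw.q x ∈ tw.suppG n.toFun
    · exact Or.inr (he1 x hx ⟨hxn, tw.mem_units_of_q hx⟩)
    · exact Or.inl (he0 x hxn)

end Steinberg

end DiscreteTwist

/-! ### Isomorphisms of algebraic pairs -/

namespace AlgebraicPair

variable {R A B : Type*} [CommRing R] [NonUnitalRing A] [Module R A] [NonUnitalRing B] [Module R B]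
  {C : NonUnitalSubalgebra R A} {D : NonUnitalSubalgebra R B}

/-- An isomorphism of pairs: an algebra isomorphism that matches the two subalgebras. -/
structure PairEquiv (C : NonUnitalSubalgebra R A) (D : NonUnitalSubalgebra R B)
    extends A ≃ₗ[R] B where
  map_mul : ∀ a b : A, toLinearEquiv (a * b) = toLinearEquiv a * toLinearEquiv b
  mem_iff : ∀ a : A, a ∈ C ↔ toLinearEquiv a ∈ D

namespace PairEquiv

/-- The inverse isomorphism of pairs. -/
def symm (φ : PairEquiv C D) : PairEquiv D C where
  toLinearEquiv := φ.toLinearEquiv.symm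
  map_mul a b := φ.toLinearEquiv.injective (by simp [φ.map_mul])
  mem_iff a := by simp [φ.mem_iff]

theorem map_isNormaliserInverse (φ : PairEquiv C D) {n m : A}
    (h : IsNormaliserInverse C n m) :
    IsNormaliserInverse D (φ.toLinearEquiv n) (φ.toLinearEquiv m) where
  mul_left := by rw [← φ.map_mul, ← φ.map_mul, h.mul_left]
  mul_right := by rw [← φ.map_mul, ← φ.map_mul, h.mul_right]
  conj_mem d hd := by
    obtain ⟨c, rfl⟩ := φ.toLinearEquiv.surjective d
    rw [← φ.map_mul, ← φ.map_mul, ← φ.mem_iff]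
    exact h.conj_mem c ((φ.mem_iff c).2 hd)
  conj_mem' d hd := by
    obtain ⟨c, rfl⟩ := φ.toLinearEquiv.surjective d
    rw [← φ.map_mul, ← φ.map_mul, ← φ.mem_iff]
    exact h.conj_mem' c ((φ.mem_iff c).2 hd)

theorem map_mem_normalisers (φ : PairEquiv C D) {n : A} (h : n ∈ normalisers C) :
    φ.toLinearEquiv n ∈ normalisers D :=
  let ⟨m, hm⟩ := h
  ⟨φ.toLinearEquiv m, φ.map_isNormaliserInverse hm⟩

theorem map_mem_freeNormalisers (φ : PairEquiv C D) {n : A} (h : n ∈ freeNormalisers C) :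
    φ.toLinearEquiv n ∈ freeNormalisers D := by
  refine ⟨φ.map_mem_normalisers h.1, h.2.imp (φ.mem_iff n).1 ?_⟩
  rintro ⟨m, hm, h0⟩
  refine ⟨φ.toLinearEquiv m, φ.map_isNormaliserInverse hm, ?_⟩
  rw [← φ.map_mul, ← φ.map_mul, ← φ.map_mul, h0, map_zero]

theorem map_mem_idempotents (φ : PairEquiv C D) {e : A} (h : e ∈ idempotents C) :
    φ.toLinearEquiv e ∈ idempotents D :=
  ⟨(φ.mem_iff e).1 h.1, by rw [← φ.map_mul, h.2]⟩

theorem span_eq_top (φ : PairEquiv C D) {s : Set A} {t : Set B}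
    (hst : ∀ a ∈ s, φ.toLinearEquiv a ∈ t) (h : Submodule.span R s = ⊤) :
    Submodule.span R t = ⊤ := by
  refine eq_top_iff.2 ?_
  have h1 : Submodule.map φ.toLinearEquiv.toLinearMap (Submodule.span R s) = ⊤ := by
    rw [h, Submodule.map_top]
    exact LinearMap.range_eq_top.2 φ.toLinearEquiv.surjective
  rw [← h1, Submodule.map_span]
  refine Submodule.span_mono ?_
  rintro _ ⟨a, ha, rfl⟩
  exact hst a ha

/-- The conjugate of a linear map onto the subalgebra by an isomorphism of pairs. -/
def conjMap (φ : PairEquiv C D) (P : A →ₗ[R] C) : B →ₗ[R] D where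
  toFun b := ⟨φ.toLinearEquiv (P (φ.toLinearEquiv.symm b)), (φ.mem_iff _).1 (P _).2⟩
  map_add' a b := Subtype.ext (by simp)
  map_smul' r a := Subtype.ext (by simp)

theorem conjMap_coe (φ : PairEquiv C D) (P : A →ₗ[R] C) (a : A) :
    (φ.conjMap P (φ.toLinearEquiv a) : B) = φ.toLinearEquiv (P a) := by
  change φ.toLinearEquiv (P (φ.toLinearEquiv.symm (φ.toLinearEquiv a))) = _
  rw [LinearEquiv.symm_apply_apply]

theorem isFaithfulExpectation_conjMap (φ : PairEquiv C D) {P : A →ₗ[R] C}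
    (hP : IsFaithfulExpectation C P) : IsFaithfulExpectation D (φ.conjMap P) where
  apply_coe := by
    rintro ⟨d, hd⟩
    obtain ⟨c, rfl⟩ := φ.toLinearEquiv.surjective d
    apply Subtype.ext
    rw [φ.conjMap_coe, hP.apply_coe ⟨c, (φ.mem_iff c).2 hd⟩]
  bimodule := by
    rintro a ⟨d, hd⟩ ⟨d', hd'⟩
    obtain ⟨a, rfl⟩ := φ.toLinearEquiv.surjective a
    obtain ⟨c, rfl⟩ := φ.toLinearEquiv.surjective d
    obtain ⟨c', rfl⟩ := φ.toLinearEquiv.surjective d'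
    apply Subtype.ext
    change (φ.conjMap P (φ.toLinearEquiv c * φ.toLinearEquiv a * φ.toLinearEquiv c') : B) =
      φ.toLinearEquiv c * (φ.conjMap P (φ.toLinearEquiv a) : B) * φ.toLinearEquiv c'
    have h := hP.bimodule a ⟨c, (φ.mem_iff c).2 hd⟩ ⟨c', (φ.mem_iff c').2 hd'⟩
    rw [φ.conjMap_coe, ← φ.map_mul, ← φ.map_mul, φ.conjMap_coe, ← φ.map_mul, ← φ.map_mul]
    exact congrArg φ.toLinearEquiv (congrArg Subtype.val h)
  faithful b hb := by
    obtain ⟨a, rfl⟩ := φ.toLinearEquiv.surjective b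
    obtain ⟨n, hn, hne⟩ := hP.faithful a fun h => hb (by rw [h, map_zero])
    refine ⟨φ.toLinearEquiv n, φ.map_mem_normalisers hn, fun h => hne (Subtype.ext ?_)⟩
    have h1 := congrArg Subtype.val h
    rw [← φ.map_mul, φ.conjMap_coe] at h1
    exact φ.toLinearEquiv.injective (h1.trans (map_zero φ.toLinearEquiv).symm)

theorem isBasicPair (φ : PairEquiv C D) (h : IsBasicPair C) : IsBasicPair D where
  comm c hc d hd := by
    have h1 := h.comm _ ((φ.symm.mem_iff c).1 hc) _ ((φ.symm.mem_iff d).1 hd)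
    rw [← φ.symm.map_mul, ← φ.symm.map_mul] at h1
    exact φ.symm.toLinearEquiv.injective h1
  without_torsion e he hne t ht := by
    refine h.without_torsion _ (φ.symm.map_mem_idempotents he)
      (fun h0 => hne (φ.symm.toLinearEquiv.injective (h0.trans (map_zero _).symm))) t ?_
    rw [← map_smul, ht, map_zero]
  local_units F := by
    classical
    obtain ⟨e, he, hu⟩ := h.local_units (F.image φ.symm.toLinearEquiv)
    refine ⟨_, φ.map_mem_idempotents he, fun b hb => ?_⟩
    have h1 := hu _ (Finset.mem_image_of_mem _ hb)
    obtain ⟨a, rfl⟩ := φ.toLinearEquiv.surjective b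
    have h2 : φ.symm.toLinearEquiv (φ.toLinearEquiv a) = a :=
      φ.toLinearEquiv.symm_apply_apply a
    rw [h2] at h1
    rw [← φ.map_mul, ← φ.map_mul, h1.1, h1.2]
    exact ⟨rfl, rfl⟩
  span_idempotents := by
    refine le_antisymm (Submodule.span_le.2 fun e he => he.1) fun d hd => ?_
    obtain ⟨c, rfl⟩ := φ.toLinearEquiv.surjective d
    have hc : c ∈ C.toSubmodule := (φ.mem_iff c).2 hd
    rw [← h.span_idempotents] at hc
    have h1 := Submodule.mem_map_of_mem (f := φ.toLinearEquiv.toLinearMap) hc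
    rw [Submodule.map_span] at h1
    refine Submodule.span_mono ?_ h1
    rintro _ ⟨e, he, rfl⟩
    exact φ.map_mem_idempotents he
  span_normalisers := φ.span_eq_top (fun _ => φ.map_mem_normalisers) h.span_normalisers
  exists_expectation :=
    let ⟨P, hP⟩ := h.exists_expectation
    ⟨φ.conjMap P, φ.isFaithfulExpectation_conjMap hP⟩

theorem isADP (φ : PairEquiv C D) (h : IsADP C) : IsADP D where
  toIsBasicPair := φ.isBasicPair h.toIsBasicPair
  span_free := φ.span_eq_top (fun _ => φ.map_mem_freeNormalisers) h.span_free

theorem isACP (φ : PairEquiv C D) (h : IsACP C) : IsACP D where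
  toIsBasicPair := φ.isBasicPair h.toIsBasicPair
  maximal E hE hDE := by
    -- the preimage of `E` in `A`
    let E' : NonUnitalSubalgebra R A :=
      { toSubmodule := E.toSubmodule.comap φ.toLinearEquiv.toLinearMap
        mul_mem' := fun {a b} ha hb => by
          change φ.toLinearEquiv (a * b) ∈ E
          rw [φ.map_mul]
          exact E.mul_mem ha hb }
    have h1 : E' = C := by
      refine h.maximal E' (fun a ha b hb => φ.toLinearEquiv.injective ?_) fun c hc =>
        hDE ((φ.mem_iff c).1 hc)
      rw [φ.map_mul, φ.map_mul]
      exact hE _ ha _ hb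
    refine le_antisymm (fun b hb => ?_) hDE
    obtain ⟨a, rfl⟩ := φ.toLinearEquiv.surjective b
    have h2 : a ∈ E' := hb
    rw [h1] at h2
    exact (φ.mem_iff a).1 h2

theorem isAQP (φ : PairEquiv C D) (h : IsAQP C) : IsAQP D where
  toIsBasicPair := φ.isBasicPair h.toIsBasicPair
  implemented := by
    obtain ⟨P, hP, hI⟩ := h.implemented
    refine ⟨φ.conjMap P, φ.isFaithfulExpectation_conjMap hP, fun n hn => ?_⟩
    obtain ⟨n, rfl⟩ := φ.toLinearEquiv.surjective n
    have hn' := φ.symm.map_mem_normalisers hn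
    have h2 : φ.symm.toLinearEquiv (φ.toLinearEquiv n) = n :=
      φ.toLinearEquiv.symm_apply_apply n
    rw [h2] at hn'
    obtain ⟨e, he, h3, h4⟩ := hI n hn'
    refine ⟨_, φ.map_mem_idempotents he, ?_, ?_⟩
    · rw [φ.conjMap_coe, h3, φ.map_mul]
    · rw [← φ.map_mul, h4, φ.map_mul]

end PairEquiv

end AlgebraicPair

/-! ### Extension by zero from a clopen subgroupoid -/

namespace DiscreteTwist

section Restrict

variable {T G S : Type*} [CommGroup T] [TopologicalSpace T] [DiscreteTopology T]
  [ArrowGroupoid G] [TopologicalSpace G] [ArrowGroupoid S] [TopologicalSpace S]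
  (tw : DiscreteTwist T G S) (H : OpenSubgroupoid G)

theorem restrict_act_coe (t : T) (σ : tw.preimage H) :
    ((tw.restrict H).act t σ).1 = tw.act t σ.1 := by
  have e1 : unitsIncl H ⟨rng (⟨tw.q σ.1, σ.2⟩ : H), rng_mem_units _⟩ =
      ⟨rng (tw.q σ.1), rng_mem_units (tw.q σ.1)⟩ := Subtype.ext (H.coe_rng _)
  have h : ((tw.restrict H).i
      (⟨rng ((tw.restrict H).q σ), rng_mem_units _⟩, t)).1 =
      tw.i (⟨rng (tw.q σ.1), rng_mem_units (tw.q σ.1)⟩, t) :=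
    congrArg (fun x => tw.i (x, t)) e1
  rw [act, act, OpenSubgroupoid.coe_mul, h]
  rw [h]
  exact tw.act_composable t σ.1

end Restrict

namespace Steinberg

variable {R G S : Type*} [CommRing R] [TopologicalSpace Rˣ] [DiscreteTopology Rˣ]
  [ArrowGroupoid G] [TopologicalSpace G] [ArrowGroupoid S] [TopologicalSpace S]
  (tw : DiscreteTwist Rˣ G S) (H : OpenSubgroupoid G)

variable {tw H} in
open Classical in
/-- Extension by zero of a function on the preimage of a subgroupoid. -/
noncomputable def extendFun (f : tw.preimage H → R) (σ : S) : R :=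
  if h : σ ∈ (tw.preimage H).carrier then f ⟨σ, h⟩ else 0

variable {tw H}

theorem extendFun_coe (f : tw.preimage H → R) (σ : tw.preimage H) :
    extendFun f σ.1 = f σ :=
  dif_pos σ.2

theorem extendFun_of_notMem (f : tw.preimage H → R) {σ : S} (h : σ ∉ (tw.preimage H).carrier) :
    extendFun f σ = 0 :=
  dif_neg h

theorem suppG_extendFun (f : tw.preimage H → R) :
    tw.suppG (extendFun f) = Subtype.val '' (tw.restrict H).suppG f := by
  ext a
  constructor
  · rintro ⟨σ, hσ, rfl⟩
    by_cases h : σ ∈ (tw.preimage H).carrier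
    · exact ⟨_, ⟨⟨σ, h⟩, fun h0 => hσ ((extendFun_coe f ⟨σ, h⟩).trans h0), rfl⟩, rfl⟩
    · exact absurd (extendFun_of_notMem f h) hσ
  · rintro ⟨_, ⟨σ, hσ, rfl⟩, rfl⟩
    refine ⟨σ.1, ?_, rfl⟩
    change extendFun f σ.1 ≠ 0
    rw [extendFun_coe]
    exact hσ

theorem isContravariant_extendFun {f : tw.preimage H → R}
    (hf : (tw.restrict H).IsContravariant f) : tw.IsContravariant (extendFun f) := by
  intro t σ
  by_cases h : σ ∈ (tw.preimage H).carrier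
  · have h1 := tw.restrict_act_coe H t ⟨σ, h⟩
    have h2 := extendFun_coe f ⟨σ, h⟩
    change extendFun f σ = _ at h2
    rw [h2, ← hf, ← h1, extendFun_coe]
  · rw [extendFun_of_notMem f h, extendFun_of_notMem f (fun ht => h (by
      have ht' : tw.q (tw.act t σ) ∈ H.carrier := ht
      rwa [tw.q_act] at ht')), mul_zero]

/-- Extension by zero, as a linear map of twisted Steinberg algebras.  The subgroupoid has to be
closed for the extension to be locally constant. -/
noncomputable def extend (hH : IsClosed H.carrier) :
    (tw.restrict H).Steinberg R →ₗ[R] tw.Steinberg R where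
  toFun f := ⟨extendFun f.toFun, by
      rw [IsLocallyConstant.iff_eventually_eq]
      intro σ
      by_cases h : σ ∈ (tw.preimage H).carrier
      · have h1 := f.locallyConstant.eventually_eq ⟨σ, h⟩
        rw [nhds_subtype_eq_comap, Filter.eventually_comap] at h1
        filter_upwards [h1, (tw.preimage H).isOpen.mem_nhds h] with τ h2 hτ
        exact (extendFun_coe f.toFun ⟨τ, hτ⟩).trans
          ((h2 ⟨τ, hτ⟩ rfl).trans (extendFun_coe f.toFun ⟨σ, h⟩).symm)
      · filter_upwards [(hH.isOpen_compl.preimage tw.continuous_q).mem_nhds h] with τ hτ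
        rw [extendFun_of_notMem _ h, extendFun_of_notMem _ hτ],
    isContravariant_extendFun f.contravariant, by
      rw [suppG_extendFun]
      exact f.isCompact_suppG.image continuous_subtype_val⟩
  map_add' f g := by
    ext σ
    change extendFun (f + g).toFun σ = extendFun f.toFun σ + extendFun g.toFun σ
    by_cases h : σ ∈ (tw.preimage H).carrier
    · obtain ⟨τ, rfl⟩ : ∃ τ : tw.preimage H, τ.1 = σ := ⟨⟨σ, h⟩, rfl⟩
      simp only [extendFun_coe, toFun_add, Pi.add_apply]
    · simp only [extendFun_of_notMem _ h, add_zero]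
  map_smul' r f := by
    ext σ
    change extendFun (r • f).toFun σ = r • extendFun f.toFun σ
    by_cases h : σ ∈ (tw.preimage H).carrier
    · obtain ⟨τ, rfl⟩ : ∃ τ : tw.preimage H, τ.1 = σ := ⟨⟨σ, h⟩, rfl⟩
      simp only [extendFun_coe, toFun_smul, Pi.smul_apply]
    · simp only [extendFun_of_notMem _ h, smul_zero]

theorem extend_toFun (hH : IsClosed H.carrier) (f : (tw.restrict H).Steinberg R) :
    (extend hH f).toFun = extendFun f.toFun := rfl

theorem extend_injective (hH : IsClosed H.carrier) :
    Function.Injective (extend (R := R) (tw := tw) hH) := by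
  intro f g h
  ext σ
  rw [← extendFun_coe f.toFun, ← extendFun_coe g.toFun, ← extend_toFun hH, h, extend_toFun]

theorem exists_extend_eq (hH : IsClosed H.carrier) {f : tw.Steinberg R}
    (hf : tw.suppG f.toFun ⊆ H.carrier) : ∃ g, extend hH g = f := by
  set v : tw.preimage H → R := fun σ => f.toFun σ.1 with hv
  have he : extendFun v = f.toFun := by
    funext σ
    by_cases h : σ ∈ (tw.preimage H).carrier
    · exact extendFun_coe v ⟨σ, h⟩
    · rw [extendFun_of_notMem v h]
      by_contra hne
      exact h (hf ⟨σ, Ne.symm hne, rfl⟩)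
  refine ⟨⟨v, f.locallyConstant.comp_continuous continuous_subtype_val, fun t σ => ?_, ?_⟩,
    toFun_injective he⟩
  · simp only [hv]
    rw [restrict_act_coe, toFun_act]
  · rw [Subtype.isCompact_iff, ← suppG_extendFun, he]
    exact f.isCompact_suppG

variable [IsTopological G] [T2Space G] [IsAmple G] [IsTopological S]

theorem extend_mul (hH : IsClosed H.carrier) (f g : (tw.restrict H).Steinberg R) :
    extend hH (f * g) = extend hH f * extend hH g := by
  ext σ
  by_cases h : σ ∈ (tw.preimage H).carrier
  · obtain ⟨σ, rfl⟩ : ∃ τ : tw.preimage H, τ.1 = σ := ⟨⟨σ, h⟩, rfl⟩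
    rw [extend_toFun, extendFun_coe, toFun_mul, toFun_mul, extend_toFun, extend_toFun]
    set F := (tw.restrict H).fibre f.isCompact_suppG σ with hF
    have hr : ∀ a : H, rng a = rng ((tw.restrict H).q σ) ↔ rng a.1 = rng (tw.q σ.1) := by
      intro a
      rw [Subtype.ext_iff, H.coe_rng, H.coe_rng]
      rfl
    have hqs : ∀ a : H, tw.q ((tw.restrict H).sec a).1 = a.1 := fun a =>
      congrArg Subtype.val ((tw.restrict H).q_sec a)
    have hF1 : ∀ a ∈ F, rng a = rng ((tw.restrict H).q σ) := fun a ha => ((mem_fibre _).1 ha).1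
    rw [conv_eq_sum_sec f.contravariant g.contravariant F hF1
        (fun a ha h => (mem_fibre _).2 ⟨ha, h⟩),
      conv_eq_sum (isContravariant_extendFun f.contravariant)
        (isContravariant_extendFun g.contravariant) F (fun a => ((tw.restrict H).sec a).1)]
    · refine Finset.sum_congr rfl fun a ha => ?_
      have hc : Composable ((tw.restrict H).sec a)⁻¹.1 σ.1 := by
        refine tw.composable_inv_of_rng ?_
        rw [hqs]
        exact (hr a).1 (hF1 a ha)
      rw [extendFun_coe, ← extendFun_coe g.toFun, OpenSubgroupoid.coe_mul _ hc]
      rfl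
    · intro a ha
      rw [hqs]
      exact (hr a).1 (hF1 a ha)
    · intro a _ b _ hab
      rw [hqs, hqs] at hab
      exact Subtype.ext hab
    · intro ρ hρ hne _
      have hρH : tw.q ρ ∈ H.carrier := by
        by_contra hρH
        exact hne (extendFun_of_notMem _ hρH)
      obtain ⟨ρ, rfl⟩ : ∃ τ : tw.preimage H, τ.1 = ρ := ⟨⟨ρ, hρH⟩, rfl⟩
      rw [extendFun_coe] at hne
      exact ⟨(tw.restrict H).q ρ, (mem_fibre _).2 ⟨(hr _).2 hρ, ⟨ρ, hne, rfl⟩⟩, hqs _⟩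
  · rw [extend_toFun, extendFun_of_notMem _ h]
    by_contra hne
    obtain ⟨a, ha, b, hb, hab, e⟩ := exists_mul_of_mul_ne_zero (Ne.symm hne)
    rw [extend_toFun, suppG_extendFun] at ha hb
    obtain ⟨a, -, rfl⟩ := ha
    obtain ⟨b, -, rfl⟩ := hb
    refine h (show tw.q σ ∈ H.carrier from ?_)
    rw [e]
    exact H.mul_mem a.2 b.2 hab

theorem extend_mem_diagonal_iff (hH : IsClosed H.carrier) (f : (tw.restrict H).Steinberg R) :
    f ∈ diagonal R (tw.restrict H) ↔ extend hH f ∈ diagonal R tw := by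
  rw [mem_diagonal_iff, mem_diagonal_iff, extend_toFun, suppG_extendFun, image_subset_iff]
  have h : (Subtype.val ⁻¹' units G : Set H) = units H :=
    Set.ext fun a => (H.mem_units_iff).symm
  rw [h]

end Steinberg

end DiscreteTwist

/-! ### The grading -/

namespace GradedDiscreteTwist

open Steinberg

variable {R Γ G S : Type*} [CommRing R] [TopologicalSpace Rˣ] [DiscreteTopology Rˣ]
  [ArrowGroupoid G] [TopologicalSpace G] [IsTopological G] [T2Space G] [IsAmple G]
  [ArrowGroupoid S] [TopologicalSpace S] [IsTopological S]
  [Group Γ] [TopologicalSpace Γ] [DiscreteTopology Γ]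
  (tw : GradedDiscreteTwist Γ Rˣ G S)

theorem mem_component_iff {γ : Γ} {f : tw.toDiscreteTwist.Steinberg R} :
    f ∈ tw.component R γ ↔ tw.toDiscreteTwist.suppG f.toFun ⊆ tw.cG ⁻¹' {γ} := Iff.rfl

omit [IsTopological G] [T2Space G] [IsAmple G] [IsTopological S] in
theorem cG_of_mem_units {a : G} (ha : a ∈ units G) : tw.cG a = 1 := by
  obtain ⟨b, rfl⟩ := ha
  rw [src, tw.cG_mul _ _ (composable_inv_left b), tw.cG_inv, _root_.inv_mul_cancel]

/-- The homogeneous normalisers span, because the degree is locally constant on the base groupoid,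
so that monomials with small support are homogeneous. -/
theorem span_homogeneousNormalisers :
    Submodule.span R (homogeneousNormalisers (tw.component R)
      (diagonal R tw.toDiscreteTwist)) = ⊤ :=
  eq_top_of_isMonomial_mem _ fun a => ⟨tw.cG ⁻¹' {tw.cG a},
    (isOpen_discrete _).preimage tw.continuous_cG, rfl,
    fun _ hu huU => Submodule.subset_span ⟨hu.mem_normalisers, tw.cG a, huU⟩⟩

theorem isGrading_component : IsGrading (tw.component R) where
  isInternal := by
    classical
    rw [DirectSum.isInternal_submodule_iff_iSupIndep_and_iSup_eq_top]
    constructor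
    · intro γ
      rw [Submodule.disjoint_def]
      intro f hf hf'
      have hle : ⨆ δ, ⨆ (_ : δ ≠ γ), tw.component R δ ≤
          supportedIn R tw.toDiscreteTwist (tw.cG ⁻¹' {γ}ᶜ) := by
        refine iSup₂_le fun δ hδ g hg => ?_
        refine Subset.trans (show tw.toDiscreteTwist.suppG g.toFun ⊆ _ from hg) fun a ha => ?_
        have ha' : tw.cG a = δ := ha
        change tw.cG a ≠ γ
        rwa [ha']
      ext σ
      by_contra hne
      exact hle hf' ⟨σ, hne, rfl⟩ (hf ⟨σ, hne, rfl⟩)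
    · rw [eq_top_iff, ← tw.span_homogeneousNormalisers, Submodule.span_le]
      rintro n ⟨-, γ, hn⟩
      exact Submodule.mem_iSup_of_mem γ hn
  mul_mem {γ δ f g} hf hg := by
    rintro _ ⟨σ, hσ, rfl⟩
    obtain ⟨a, ha, b, hb, hab, e⟩ := exists_mul_of_mul_ne_zero hσ
    have ha' : tw.cG a = γ := hf ha
    have hb' : tw.cG b = δ := hg hb
    change tw.cG _ = _
    rw [e, tw.cG_mul a b hab, ha', hb']

theorem isGradedBasicPair :
    IsGradedBasicPair (tw.component R) (diagonal R tw.toDiscreteTwist) where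
  grading := tw.isGrading_component
  le_one f hf := Subset.trans (show tw.toDiscreteTwist.suppG f.toFun ⊆ _ from hf)
    fun _ ha => tw.cG_of_mem_units ha
  span_homogeneous := tw.span_homogeneousNormalisers

omit [IsTopological G] [T2Space G] [IsAmple G] [IsTopological S] in
theorem isClosed_identityPart : IsClosed tw.identityPart.carrier :=
  (isClosed_discrete _).preimage tw.continuous_cG

/-- Extension by zero identifies the twisted Steinberg algebra of the identity part with the
identity component of the graded algebra, compatibly with the diagonals. -/
noncomputable def pairEquiv (h : IsGrading (tw.component R)) :
    PairEquiv (diagonal R tw.identityTwist) (h.inOne (diagonal R tw.toDiscreteTwist)) where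
  toLinearEquiv := LinearEquiv.ofBijective
    ((extend tw.isClosed_identityPart).codRestrict (tw.component R 1) fun f => by
      rw [mem_component_iff, extend_toFun, suppG_extendFun]
      rintro _ ⟨a, -, rfl⟩
      exact a.2)
    ⟨fun f g hfg => extend_injective tw.isClosed_identityPart (congrArg Subtype.val hfg),
      fun f =>
        let ⟨g, hg⟩ := exists_extend_eq tw.isClosed_identityPart
          (show tw.toDiscreteTwist.suppG f.1.toFun ⊆ tw.identityPart.carrier from f.2)
        ⟨g, Subtype.ext hg⟩⟩
  map_mul f g := Subtype.ext (extend_mul tw.isClosed_identityPart f g)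
  mem_iff f := extend_mem_diagonal_iff tw.isClosed_identityPart f

end GradedDiscreteTwist

theorem mainTheorem4 {R G S Γ : Type*} [CommRing R]
    (hR : ∀ e : R, e * e = e → e = 0 ∨ e = 1)
    [TopologicalSpace Rˣ] [DiscreteTopology Rˣ]
    [ArrowGroupoid G] [TopologicalSpace G] [IsTopological G] [T2Space G] [IsAmple G]
    [ArrowGroupoid S] [TopologicalSpace S] [IsTopological S]
    [Group Γ] [TopologicalSpace Γ] [DiscreteTopology Γ]
    (tw : GradedDiscreteTwist Γ Rˣ G S) :
    (IsEffective tw.identityPart →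
      IsGrACP (tw.component R) (Steinberg.diagonal R tw.toDiscreteTwist)) ∧
    (IsPrincipal tw.identityPart →
      IsGrADP (tw.component R) (Steinberg.diagonal R tw.toDiscreteTwist)) ∧
    (IsGrAQP (tw.component R) (Steinberg.diagonal R tw.toDiscreteTwist) ↔
      LocalBisectionHypothesis R tw.identityTwist) := by
  refine ⟨fun h => ⟨tw.isGradedBasicPair, ?_⟩, fun h => ⟨tw.isGradedBasicPair, ?_⟩,
    fun h => ?_, fun h => ⟨tw.isGradedBasicPair, ?_⟩⟩
  · exact (tw.pairEquiv _).isACP (Steinberg.isACP_diagonal tw.identityTwist hR h)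
  · exact (tw.pairEquiv _).isADP (Steinberg.isADP_diagonal tw.identityTwist hR h)
  · exact (Steinberg.isAQP_diagonal_iff tw.identityTwist hR).1
      ((tw.pairEquiv h.grading).symm.isAQP h.isAQP)
  · exact (tw.pairEquiv _).isAQP ((Steinberg.isAQP_diagonal_iff tw.identityTwist hR).2 h)
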